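/- Let $0<\alpha\le\beta<1$. Let $\mathcal M$ be the set of measurable profiles $m:[0,1]\to[0,1]$ and let $\mathcal M_-\subset\mathcal M$ be the set of profiles $m=\mathbf 1\{[x_0,1]\}$ with $x_0\in[0,1]$. Let $\mathcal F$ be the set of increasing $C^1$ functions $F$ on $[0,1]$ with $F(0)=\alpha$, $F(1)=\beta$. For $m\in\mathcal M$ let $$V(m)=\int_0^1\Big\{m\log\frac mF+(1-m)\log\frac{1-m}{1-F}+\log\frac{F'}{\beta-\alpha}\Big\}\,dx,$$ $$\mathbb S(m)=-\int_0^1\{m\log m+(1-m)\log(1-m)\}\,dx,$$ where $F$ is the increasing $C^1$ solution of $$F''=(m-F)\frac{(F')^2}{F(1-F)}\ \text{ a.e. (with $F'$ absolutely continuous)},\qquad F(0)=\alpha,\ F(1)=\beta,$$ and for $m\in\mathcal M$, $F\in\mathcal F$ let $$\mathcal G(m,F)=-\int_0^1\Big\{m\log F+(1-m)\log(1-F)-\log\frac{F'}{\beta-\alpha}\Big\}\,dx\in[-\infty,\infty).$$ Let $$E_-=\log\Big(\frac1{\beta-\alpha}\int_\alpha^\beta\frac{dx}{\max\{x,1-x\}}\Big)\quad\text{if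 }\alpha<\beta.$$ In the equilibrium case $\alpha=\beta$ ("increasing" is meant in the weak sense, so that $F\equiv\alpha$) the term $\log\frac{F'}{\beta-\alpha}$ is read as $0$ and $E_-=-\log\max\{\alpha,1-\alpha\}$. **Lemma.** For every $m\in\mathcal M$ the above boundary value problem has exactly one increasing solution, so that $V$ is well defined, and $$\inf_{m\in\mathcal M}\{V(m)+\mathbb S(m)\}=\inf_{m\in\mathcal M_-}\{V(m)+\mathbb S(m)\}=E_-.$$ A minimizing profile is $\mathbf 1\{[x^*,1]\}$, where $$x^*=\frac{\log(2(1-\alpha))}{\log(4(1-\alpha)\beta)}\in[0,1]\quad\text{if }\alpha\le\tfrac12\le\beta,\ \alpha<\beta,$$ $x^*=0$ if $\alpha\ge\frac12$, and $x^*=1$ if $\beta\le\frac12$. Moreover $$\inf_{m\in\mathcal M}\sup_{F\in\mathcal F}\mathcal G(m,F)=\sup_{F\in\mathcal F}\inf_{m\in\mathcal M}\mathcal G(m,F)=E_-.$$ -/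

import Mathlib

open MeasureTheory Set

namespace SSEP

noncomputable section

/-- The set `ℳ` of measurable profiles `m : [0,1] → [0,1]`. Only the restriction of `m` to
`[0,1]` matters; measurability is Lebesgue measurability on `[0,1]`. -/
def profiles : Set (ℝ → ℝ) :=
  {m | AEMeasurable m (volume.restrict (Icc (0 : ℝ) 1)) ∧
    ∀ x ∈ Icc (0 : ℝ) 1, m x ∈ Icc (0 : ℝ) 1}

/-- The profile `𝟏{[x₀, 1]}`. -/
def step (x₀ : ℝ) : ℝ → ℝ := (Icc x₀ 1).indicator (fun _ => (1 : ℝ))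

/-- The set `ℳ₋` of profiles `𝟏{[x₀, 1]}` with `x₀ ∈ [0,1]`. -/
def stepProfiles : Set (ℝ → ℝ) := step '' Icc (0 : ℝ) 1

/-- The derivative of a function on `[0,1]` (one-sided at the end points). -/
def D (F : ℝ → ℝ) (x : ℝ) : ℝ := derivWithin F (Icc (0 : ℝ) 1) x

/-- The set `ℱ` of increasing `C¹` functions on `[0,1]` with `F(0) = α` and `F(1) = β`. -/
def increasingC1 (α β : ℝ) : Set (ℝ → ℝ) :=
  {F | ContDiffOn ℝ 1 F (Icc (0 : ℝ) 1) ∧ MonotoneOn F (Icc (0 : ℝ) 1) ∧ F 0 = α ∧ F 1 = β}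

/-- `F` is an increasing `C¹` solution of
`F'' = (m - F) (F')² / (F (1 - F))`, `F(0) = α`, `F(1) = β`.
As `m` is only measurable, the equation means that `F'` is absolutely continuous and that the
equation holds almost everywhere; this is written in the integrated form. -/
def IsBVPSolution (α β : ℝ) (m F : ℝ → ℝ) : Prop :=
  F ∈ increasingC1 α β ∧
    ∀ x ∈ Icc (0 : ℝ) 1,
      D F x = D F 0 + ∫ y in (0 : ℝ)..x, (m y - F y) * (D F y) ^ 2 / (F y * (1 - F y))

/-- The solution `F` of the boundary value problem associated with `m`. -/
def bvpSolution (α β : ℝ) (m : ℝ → ℝ) : ℝ → ℝ := Classical.epsilon (IsBVPSolution α β m)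

/-- The nonequilibrium free energy `V(m)`. The term `log (F' / (β - α))` is read as `0` in the
equilibrium case `α = β`, where `F` is constant. -/
def V (α β : ℝ) (m : ℝ → ℝ) : ℝ :=
  ∫ x in (0 : ℝ)..1,
    (m x * Real.log (m x / bvpSolution α β m x)
      + (1 - m x) * Real.log ((1 - m x) / (1 - bvpSolution α β m x))
      + if α = β then 0 else Real.log (D (bvpSolution α β m) x / (β - α)))

/-- `s(θ) = θ log θ + (1 - θ) log (1 - θ)`, with `0 log 0 = 0`. -/
def s (θ : ℝ) : ℝ := θ * Real.log θ + (1 - θ) * Real.log (1 - θ)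

/-- The Gibbs-Shannon entropy `𝕊(m) = - ∫ s(m(x)) dx`. -/
def S (m : ℝ → ℝ) : ℝ := - ∫ x in (0 : ℝ)..1, s (m x)

/-- The lowest energy `E₋`; for `α = β` it is the equilibrium value, which is also the limit of
the general expression. -/
def Eminus (α β : ℝ) : ℝ :=
  if α = β then - Real.log (max α (1 - α))
  else Real.log (1 / (β - α) * ∫ x in α..β, 1 / max x (1 - x))

/-- The integral over `[0,1]` of an extended real valued function: the integral of its positive
part minus the integral of its negative part. -/
def extIntegral (g : ℝ → EReal) : EReal :=
  ((∫⁻ x in Icc (0 : ℝ) 1, (g x).toENNReal : ENNReal) : EReal)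
    - ((∫⁻ x in Icc (0 : ℝ) 1, (- g x).toENNReal : ENNReal) : EReal)

/-- `log (F' / (β - α))` with `log 0 = -∞`, read as `0` in the equilibrium case `α = β`. -/
def logSlope (α β : ℝ) (F : ℝ → ℝ) (x : ℝ) : EReal :=
  if α = β then 0 else ENNReal.log (ENNReal.ofReal (D F x / (β - α)))

/-- `𝒢(m, F) = - ∫ { m log F + (1 - m) log (1 - F) - log (F' / (β - α)) } dx`, with values in
`[-∞, ∞)` for `m ∈ ℳ` and `F ∈ ℱ`. -/
def G (α β : ℝ) (m F : ℝ → ℝ) : EReal :=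
  extIntegral fun x =>
    ((-(m x * Real.log (F x) + (1 - m x) * Real.log (1 - F x)) : ℝ) : EReal) + logSlope α β F x

end

end SSEP

/-!
The functional `𝒢` has a saddle point `(𝟏{[x₀, 1]}, F)` of value `E₋` (`IsSaddlePoint`), and
everything about infima follows from it by weak duality.

In the variable `φ = log (F / (1 - F))` the integrand of `𝒢(m, ·)` is, up to a constant,
`(1 - m) φ - log (1 + e^φ) + log φ'`, which is strictly concave in `φ`. Its Euler-Lagrange
equation is the boundary value problem, and with `w = 1 / φ'` it is the first order system
`F' = F (1 - F) / w`, `w' = 1 - F - m` (`IsFirstOrderSolution`).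
* Tangent line inequality: integrating it against the solution shows that the solution maximizes
  `𝒢(m, ·)` over `ℱ` (`IsBVPSolution.G_le`), and the maximum is `V(m) + 𝕊(m)`
  (`IsBVPSolution.coe_V_add_S`).
* Uniqueness: for two solutions `(φ₁ - φ₂) (w₁ - w₂)` is nonincreasing and vanishes at `0` and `1`
  (`IsFirstOrderSolution.eqOn`).
* Existence: shooting in `w 0`. The variable `u = w + ∫ m` makes the vector field continuous in
  time, so that the Picard-Lindelöf theorem applies once `1 / w` is cut off; since `|w'| ≤ 1`, a
  solution that reached the cutoff would have too large a gain `∫ 1 / w`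
  (`exists_isFirstOrderSolution`).

On the other side `𝒢(·, F)` is minimized by `𝟏{F ≥ 1/2}`. The solution of
`F' = κ max F (1 - F)` makes the minimal integrand constant, equal to `E₋`; it is increasing, so
`𝟏{F ≥ 1/2}` is a step, and for that step it solves the boundary value problem
(`isSaddlePoint_optCurve`). As `m` is only measurable, derivatives are those of absolutely
continuous functions (`HasACDeriv`).
-/

open scoped NNReal

namespace SSEP

/-! ### Absolutely continuous functions on the unit interval -/

/-- `f` is absolutely continuous on `[0,1]`, with derivative `g` almost everywhere there. -/
structure HasACDeriv (f g : ℝ → ℝ) : Prop where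
  ac : AbsolutelyContinuousOnInterval f 0 1
  ae : ∀ᵐ x, x ∈ Icc (0 : ℝ) 1 → HasDerivAt f (g x) x

lemma ae_mem_Ioo : ∀ᵐ x : ℝ, x ∈ Icc (0 : ℝ) 1 → x ∈ Ioo (0 : ℝ) 1 := by
  filter_upwards [Measure.ae_ne volume (0 : ℝ), Measure.ae_ne volume (1 : ℝ)] with x h0 h1 hx
  exact ⟨lt_of_le_of_ne hx.1 (Ne.symm h0), lt_of_le_of_ne hx.2 h1⟩

lemma absolutelyContinuousOnInterval_congr {f g : ℝ → ℝ} {a b : ℝ}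
    (hf : AbsolutelyContinuousOnInterval f a b) (h : EqOn g f (uIcc a b)) :
    AbsolutelyContinuousOnInterval g a b := by
  rw [absolutelyContinuousOnInterval_iff] at hf ⊢
  intro ε hε
  obtain ⟨δ, hδ, H⟩ := hf ε hε
  refine ⟨δ, hδ, fun E hE hE' => ?_⟩
  convert H E hE hE' using 1
  refine Finset.sum_congr rfl fun i hi => ?_
  rw [h (hE.1 i hi).1, h (hE.1 i hi).2]

lemma continuousOn_mul_sub {F : ℝ → ℝ} {t : Set ℝ} (hF : ContinuousOn F t) :
    ContinuousOn (fun x => F x * (1 - F x)) t :=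
  hF.mul (continuousOn_const.sub hF)

namespace HasACDeriv

variable {f g f₁ g₁ f₂ g₂ : ℝ → ℝ}

lemma continuousOn (h : HasACDeriv f g) : ContinuousOn f (Icc 0 1) := by
  simpa [uIcc_of_le] using h.ac.continuousOn

lemma congr_deriv (h : HasACDeriv f g) (hg : ∀ x ∈ Icc (0 : ℝ) 1, g x = g₁ x) :
    HasACDeriv f g₁ := by
  refine ⟨h.ac, ?_⟩
  filter_upwards [h.ae] with x hx hx'
  rw [← hg x hx']
  exact hx hx'

lemma of_hasDerivWithinAt
    (hf : ∀ x ∈ Icc (0 : ℝ) 1, HasDerivWithinAt f (g x) (Icc 0 1) x)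
    (hg : ContinuousOn g (Icc 0 1)) : HasACDeriv f g := by
  constructor
  · apply ContDiffOn.absolutelyContinuousOnInterval
    rw [uIcc_of_le zero_le_one]
    have hu : UniqueDiffOn ℝ (Icc (0 : ℝ) 1) := uniqueDiffOn_Icc one_pos
    rw [show (1 : WithTop ℕ∞) = 0 + 1 from rfl, contDiffOn_succ_iff_derivWithin hu]
    refine ⟨fun x hx => (hf x hx).differentiableWithinAt, by simp, ?_⟩
    rw [contDiffOn_zero]
    exact hg.congr fun x hx => (hf x hx).derivWithin (hu x hx)
  · filter_upwards [ae_mem_Ioo] with x hx hx'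
    exact (hf x hx').hasDerivAt (Icc_mem_nhds (hx hx').1 (hx hx').2)

lemma of_primitive (hg : IntervalIntegrable g volume 0 1)
    (hf : ∀ x ∈ Icc (0 : ℝ) 1, f x = f 0 + ∫ y in (0 : ℝ)..x, g y) : HasACDeriv f g := by
  have h0 : (0 : ℝ) ∈ uIcc (0 : ℝ) 1 := by simp
  constructor
  · have h1 := hg.absolutelyContinuousOnInterval_intervalIntegral h0
    have h2 : AbsolutelyContinuousOnInterval (fun _ : ℝ => f 0) 0 1 :=
      ContDiffOn.absolutelyContinuousOnInterval contDiffOn_const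
    refine absolutelyContinuousOnInterval_congr (h2.add h1) fun x hx => ?_
    rw [uIcc_of_le zero_le_one] at hx
    simpa using hf x hx
  · filter_upwards [ae_mem_Ioo, hg.ae_hasDerivAt_integral] with x hx h hx'
    rw [uIcc_of_le zero_le_one] at h
    have h3 := (h hx' 0 (by simp)).const_add (f 0)
    refine h3.congr_of_eventuallyEq ?_
    filter_upwards [Icc_mem_nhds (hx hx').1 (hx hx').2] with y hy
    exact hf y hy

lemma sub (h₁ : HasACDeriv f₁ g₁) (h₂ : HasACDeriv f₂ g₂) :
    HasACDeriv (fun x => f₁ x - f₂ x) (fun x => g₁ x - g₂ x) := by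
  refine ⟨h₁.ac.sub h₂.ac, ?_⟩
  filter_upwards [h₁.ae, h₂.ae] with x k₁ k₂ hx
  exact (k₁ hx).sub (k₂ hx)

lemma mul (h₁ : HasACDeriv f₁ g₁) (h₂ : HasACDeriv f₂ g₂) :
    HasACDeriv (fun x => f₁ x * f₂ x) (fun x => g₁ x * f₂ x + f₁ x * g₂ x) := by
  refine ⟨h₁.ac.mul h₂.ac, ?_⟩
  filter_upwards [h₁.ae, h₂.ae] with x k₁ k₂ hx
  exact (k₁ hx).mul (k₂ hx)

/-- The fundamental theorem of calculus. -/
lemma integral_eq_sub (h : HasACDeriv f g) {a b : ℝ} (ha : a ∈ Icc (0 : ℝ) 1)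
    (hb : b ∈ Icc (0 : ℝ) 1) : ∫ x in a..b, g x = f b - f a := by
  have hsub : uIcc a b ⊆ Icc 0 1 := ordConnected_Icc.uIcc_subset ha hb
  rw [← (h.ac.mono (by rwa [uIcc_of_le zero_le_one])).integral_deriv_eq_sub]
  refine intervalIntegral.integral_congr_ae ?_
  filter_upwards [h.ae] with x hx hx'
  exact ((hx (hsub (uIoc_subset_uIcc hx'))).deriv).symm

lemma intervalIntegrable (h : HasACDeriv f g) : IntervalIntegrable g volume 0 1 := by
  refine h.ac.intervalIntegrable_deriv.congr_ae ?_
  rw [Filter.EventuallyEq, ae_restrict_iff' measurableSet_uIoc]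
  filter_upwards [h.ae] with x hx hx'
  rw [uIoc_of_le zero_le_one] at hx'
  exact (hx (Ioc_subset_Icc_self hx')).deriv

lemma antitoneOn (h : HasACDeriv f g)
    (hg : ∀ᵐ x, x ∈ Icc (0 : ℝ) 1 → g x ≤ 0) : AntitoneOn f (Icc 0 1) := by
  intro a ha b hb hab
  rw [← sub_nonpos, ← h.integral_eq_sub ha hb]
  rw [← neg_nonneg, ← intervalIntegral.integral_neg]
  refine intervalIntegral.integral_nonneg_of_ae_restrict hab ?_
  rw [Filter.EventuallyLE, ae_restrict_iff' measurableSet_Icc]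
  filter_upwards [hg] with x hx hx'
  exact neg_nonneg.2 (hx ⟨ha.1.trans hx'.1, hx'.2.trans hb.2⟩)

/-- Gronwall: an absolutely continuous function with `|f'| ≤ K |f|` that vanishes somewhere
vanishes everywhere. -/
lemma eq_zero_of_abs_deriv_le {K : ℝ} (h : HasACDeriv f g)
    (hg : ∀ x ∈ Icc (0 : ℝ) 1, |g x| ≤ K * |f x|) {x₀ : ℝ} (hx₀ : x₀ ∈ Icc (0 : ℝ) 1)
    (hf : f x₀ = 0) : ∀ x ∈ Icc (0 : ℝ) 1, f x = 0 := by
  have hexp : ∀ c : ℝ, HasACDeriv (fun x => Real.exp (c * x)) (fun x => Real.exp (c * x) * c) :=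
    fun c => of_hasDerivWithinAt (fun x _ => by
      simpa using (((hasDerivAt_id x).const_mul c).exp).hasDerivWithinAt) (by fun_prop)
  have hff : ∀ x ∈ Icc (0 : ℝ) 1, |f x * g x| ≤ K * f x ^ 2 := fun x hx => by
    rw [abs_mul, ← sq_abs (f x)]
    nlinarith [hg x hx, abs_nonneg (f x)]
  intro x hx
  have key : f x ^ 2 ≤ 0 := by
    rcases le_total x₀ x with hle | hle
    · -- `f² exp (-2Kx)` is antitone
      have h1 := ((h.mul h).mul (hexp (-2 * K))).antitoneOn (.of_forall fun y hy => by
        have h3 := (abs_le.1 (hff y hy)).2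
        have h4 := Real.exp_pos (-2 * K * y)
        nlinarith) hx₀ hx hle
      simp only [hf, mul_zero, zero_mul] at h1
      have := Real.exp_pos (-2 * K * x)
      nlinarith [nonpos_of_mul_nonpos_left h1 this]
    · -- `-f² exp (2Kx)` is antitone
      have h0 := (of_hasDerivWithinAt (f := fun _ => 0) (g := fun _ => 0)
        (fun x _ => hasDerivWithinAt_const ..) continuousOn_const)
      have h1 := (h0.sub ((h.mul h).mul (hexp (2 * K)))).antitoneOn (.of_forall fun y hy => by
        have h3 := (abs_le.1 (hff y hy)).1
        have h4 := Real.exp_pos (2 * K * y)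
        nlinarith) hx hx₀ hle
      simp only [hf, mul_zero, zero_mul] at h1
      have := Real.exp_pos (2 * K * x)
      have h5 : f x * f x * Real.exp (2 * K * x) ≤ 0 := by linarith
      nlinarith [nonpos_of_mul_nonpos_left h5 this]
  exact pow_eq_zero_iff (two_ne_zero) |>.1 (le_antisymm key (sq_nonneg _))

end HasACDeriv

/-! ### The boundary value problem as a first order system -/

lemma intervalIntegrable_of_mem_profiles {m : ℝ → ℝ} (hm : m ∈ profiles) :
    IntervalIntegrable m volume 0 1 := by
  rw [intervalIntegrable_iff_integrableOn_Icc_of_le zero_le_one]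
  refine Integrable.of_bound hm.1.aestronglyMeasurable 1 ?_
  rw [ae_restrict_iff' measurableSet_Icc]
  refine .of_forall fun x hx => ?_
  rw [Real.norm_eq_abs, abs_of_nonneg (hm.2 x hx).1]
  exact (hm.2 x hx).2

lemma intervalIntegrable_of_continuousOn {f : ℝ → ℝ} (hf : ContinuousOn f (Icc 0 1)) :
    IntervalIntegrable f volume 0 1 :=
  ContinuousOn.intervalIntegrable (by rwa [uIcc_of_le zero_le_one])

section increasingC1

variable {α β : ℝ} {F : ℝ → ℝ}

lemma mem_Icc_of_mem_increasingC1 (hF : F ∈ increasingC1 α β) {x : ℝ} (hx : x ∈ Icc (0 : ℝ) 1) :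
    F x ∈ Icc α β := by
  obtain ⟨-, hmono, h0, h1⟩ := hF
  exact ⟨h0 ▸ hmono (by simp) hx hx.1, h1 ▸ hmono hx (by simp) hx.2⟩

lemma mem_Ioo_of_mem_increasingC1 (hα : 0 < α) (hβ : β < 1) (hF : F ∈ increasingC1 α β) {x : ℝ}
    (hx : x ∈ Icc (0 : ℝ) 1) : F x ∈ Ioo (0 : ℝ) 1 :=
  ⟨hα.trans_le (mem_Icc_of_mem_increasingC1 hF hx).1,
    (mem_Icc_of_mem_increasingC1 hF hx).2.trans_lt hβ⟩

lemma hasDerivWithinAt_D (hF : F ∈ increasingC1 α β) {x : ℝ} (hx : x ∈ Icc (0 : ℝ) 1) :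
    HasDerivWithinAt F (D F x) (Icc 0 1) x :=
  (hF.1.differentiableOn one_ne_zero x hx).hasDerivWithinAt

lemma continuousOn_D (hF : F ∈ increasingC1 α β) : ContinuousOn (D F) (Icc 0 1) :=
  hF.1.continuousOn_derivWithin (uniqueDiffOn_Icc one_pos) le_rfl

lemma D_nonneg (hF : F ∈ increasingC1 α β) (x : ℝ) : 0 ≤ D F x :=
  hF.2.1.derivWithin_nonneg

lemma hasACDeriv_D (hF : F ∈ increasingC1 α β) : HasACDeriv F (D F) :=
  .of_hasDerivWithinAt (fun _ hx => hasDerivWithinAt_D hF hx) (continuousOn_D hF)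

lemma D_eq_of_hasDerivWithinAt {d x : ℝ} (hx : x ∈ Icc (0 : ℝ) 1)
    (h : HasDerivWithinAt F d (Icc 0 1) x) : D F x = d :=
  h.derivWithin (uniqueDiffOn_Icc one_pos x hx)

lemma D_congr {F₁ F₂ : ℝ → ℝ} (h : EqOn F₁ F₂ (Icc 0 1)) {x : ℝ} (hx : x ∈ Icc (0 : ℝ) 1) :
    D F₁ x = D F₂ x :=
  derivWithin_congr h (h hx)

end increasingC1

lemma mem_increasingC1_of_hasDerivWithinAt {α β : ℝ} {F d : ℝ → ℝ}
    (hd : ∀ x ∈ Icc (0 : ℝ) 1, HasDerivWithinAt F (d x) (Icc 0 1) x)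
    (hdc : ContinuousOn d (Icc 0 1)) (hd0 : ∀ x ∈ Icc (0 : ℝ) 1, 0 ≤ d x)
    (h0 : F 0 = α) (h1 : F 1 = β) : F ∈ increasingC1 α β := by
  have hu : UniqueDiffOn ℝ (Icc (0 : ℝ) 1) := uniqueDiffOn_Icc one_pos
  refine ⟨?_, ?_, h0, h1⟩
  · rw [show (1 : WithTop ℕ∞) = 0 + 1 from rfl, contDiffOn_succ_iff_derivWithin hu]
    refine ⟨fun x hx => (hd x hx).differentiableWithinAt, by simp, ?_⟩
    rw [contDiffOn_zero]
    exact hdc.congr fun x hx => (hd x hx).derivWithin (hu x hx)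
  · refine monotoneOn_of_deriv_nonneg (convex_Icc 0 1)
      (fun x hx => (hd x hx).continuousWithinAt) (fun x hx => ?_) fun x hx => ?_
    · rw [interior_Icc] at hx
      exact ((hd x (Ioo_subset_Icc_self hx)).hasDerivAt
        (Icc_mem_nhds hx.1 hx.2)).differentiableAt.differentiableWithinAt
    · rw [interior_Icc] at hx
      rw [((hd x (Ioo_subset_Icc_self hx)).hasDerivAt (Icc_mem_nhds hx.1 hx.2)).deriv]
      exact hd0 x (Ioo_subset_Icc_self hx)

/-- The first order form `F' = F (1 - F) / w`, `w' = 1 - F - m` of the equation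
`F'' = (m - F) (F')² / (F (1 - F))`. In terms of `φ = log (F / (1 - F))` it reads `φ' = 1 / w`. -/
structure IsFirstOrderSolution (m F w : ℝ → ℝ) : Prop where
  mem : ∀ x ∈ Icc (0 : ℝ) 1, F x ∈ Ioo (0 : ℝ) 1
  pos : ∀ x ∈ Icc (0 : ℝ) 1, 0 < w x
  hasDerivWithinAt : ∀ x ∈ Icc (0 : ℝ) 1,
    HasDerivWithinAt F (F x * (1 - F x) / w x) (Icc 0 1) x
  eq_integral : ∀ x ∈ Icc (0 : ℝ) 1, w x = w 0 + ∫ y in (0 : ℝ)..x, (1 - F y - m y)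

namespace IsFirstOrderSolution

variable {m F w : ℝ → ℝ}

lemma continuousOn (h : IsFirstOrderSolution m F w) : ContinuousOn F (Icc 0 1) :=
  fun x hx => (h.hasDerivWithinAt x hx).continuousWithinAt

lemma mul_sub_pos (h : IsFirstOrderSolution m F w) {x : ℝ} (hx : x ∈ Icc (0 : ℝ) 1) :
    0 < F x * (1 - F x) :=
  mul_pos (h.mem x hx).1 (sub_pos.2 (h.mem x hx).2)

lemma hasACDeriv_w (h : IsFirstOrderSolution m F w) (hm : m ∈ profiles) :
    HasACDeriv w (fun x => 1 - F x - m x) :=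
  .of_primitive ((intervalIntegrable_of_continuousOn
    (continuousOn_const.sub h.continuousOn)).sub (intervalIntegrable_of_mem_profiles hm))
    h.eq_integral

lemma continuousOn_slope (h : IsFirstOrderSolution m F w) (hm : m ∈ profiles) :
    ContinuousOn (fun x => F x * (1 - F x) / w x) (Icc 0 1) :=
  (continuousOn_mul_sub h.continuousOn).div (h.hasACDeriv_w hm).continuousOn
    fun x hx => (h.pos x hx).ne'

lemma slope_pos (h : IsFirstOrderSolution m F w) {x : ℝ} (hx : x ∈ Icc (0 : ℝ) 1) :
    0 < F x * (1 - F x) / w x :=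
  div_pos (h.mul_sub_pos hx) (h.pos x hx)

lemma D_eq (h : IsFirstOrderSolution m F w) {x : ℝ} (hx : x ∈ Icc (0 : ℝ) 1) :
    D F x = F x * (1 - F x) / w x :=
  D_eq_of_hasDerivWithinAt hx (h.hasDerivWithinAt x hx)

lemma hasACDeriv_mul_sub (h : IsFirstOrderSolution m F w) (hm : m ∈ profiles) :
    HasACDeriv (fun x => F x * (1 - F x)) (fun x => F x * (1 - F x) / w x * (1 - 2 * F x)) := by
  have hF : HasACDeriv F (fun x => F x * (1 - F x) / w x) :=
    .of_hasDerivWithinAt h.hasDerivWithinAt (h.continuousOn_slope hm)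
  have h1 : HasACDeriv (fun _ => 1) (fun _ => 0) :=
    .of_hasDerivWithinAt (fun x _ => hasDerivWithinAt_const ..) continuousOn_const
  exact (hF.mul (h1.sub hF)).congr_deriv fun x _ => by ring

theorem isBVPSolution {α β : ℝ} (h : IsFirstOrderSolution m F w) (hm : m ∈ profiles)
    (h0 : F 0 = α) (h1 : F 1 = β) : IsBVPSolution α β m F := by
  refine ⟨mem_increasingC1_of_hasDerivWithinAt h.hasDerivWithinAt (h.continuousOn_slope hm)
    (fun x hx => (h.slope_pos hx).le) h0 h1, ?_⟩
  have hwc := (h.hasACDeriv_w hm).continuousOn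
  set r : ℝ → ℝ := fun y => (m y - F y) * D F y ^ 2 / (F y * (1 - F y)) with hr
  set g : ℝ → ℝ := fun x => D F 0 + ∫ y in (0 : ℝ)..x, r y with hg
  have hDc : ContinuousOn (D F) (Icc 0 1) := (h.continuousOn_slope hm).congr fun x hx => h.D_eq hx
  have hri : IntervalIntegrable r volume 0 1 := by
    have hc : ContinuousOn (fun y => D F y ^ 2 / (F y * (1 - F y))) (uIcc 0 1) := by
      rw [uIcc_of_le zero_le_one]
      exact (hDc.pow 2).div (continuousOn_mul_sub h.continuousOn)
        fun x hx => (h.mul_sub_pos hx).ne'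
    refine (((intervalIntegrable_of_mem_profiles hm).sub
      (intervalIntegrable_of_continuousOn h.continuousOn)).mul_continuousOn hc).congr fun x _ => ?_
    simp only [hr]
    ring
  have hgAC : HasACDeriv g r := .of_primitive hri fun x _ => by simp [hg]
  have hP := (hgAC.mul (h.hasACDeriv_w hm)).sub (h.hasACDeriv_mul_sub hm)
  -- `P = g w - F (1 - F)` satisfies the linear equation `P' = ((1 - F - m) / w) P`
  obtain ⟨δ, hδ, hδw⟩ : ∃ δ > 0, ∀ x ∈ Icc (0 : ℝ) 1, δ ≤ w x := by
    obtain ⟨x₀, hx₀, hmin⟩ := isCompact_Icc.exists_isMinOn (nonempty_Icc.2 zero_le_one) hwc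
    exact ⟨w x₀, h.pos x₀ hx₀, fun x hx => hmin hx⟩
  have hzero := hP.eq_zero_of_abs_deriv_le (K := 1 / δ) (x₀ := 0) (fun x hx => ?_) (by simp) ?_
  · intro x hx
    have h2 := hzero x hx
    rw [h.D_eq hx, div_eq_iff (h.pos x hx).ne']
    simp only [hg] at h2
    linarith
  · have hw := h.pos x hx
    have hF := h.mem x hx
    have hm' := hm.2 x hx
    have hne : F x ≠ 0 := hF.1.ne'
    have hne' : 1 - F x ≠ 0 := (sub_pos.2 hF.2).ne'
    have hlin : r x * w x + g x * (1 - F x - m x) - F x * (1 - F x) / w x * (1 - 2 * F x)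
        = (1 - F x - m x) / w x * (g x * w x - F x * (1 - F x)) := by
      simp only [hr]
      rw [h.D_eq hx]
      field_simp
      ring
    simp only [hlin]
    rw [abs_mul]
    refine mul_le_mul_of_nonneg_right ?_ (abs_nonneg _)
    rw [abs_div, abs_of_pos hw]
    refine div_le_div₀ zero_le_one ?_ hδ (hδw x hx)
    rw [abs_le]
    constructor <;> linarith [hF.1, hF.2, hm'.1, hm'.2]
  · simp only [hg, intervalIntegral.integral_same, add_zero]
    rw [h.D_eq (by simp), div_mul_cancel₀ _ (h.pos 0 (by simp)).ne', sub_self]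

end IsFirstOrderSolution

/-- Here `w = F (1 - F) / F'`. By Gronwall's inequality `F'` could vanish only identically, which
`α < β` excludes. -/
theorem IsBVPSolution.exists_isFirstOrderSolution {α β : ℝ} {m F : ℝ → ℝ} (hα : 0 < α)
    (hαβ : α < β) (hβ : β < 1) (hm : m ∈ profiles) (h : IsBVPSolution α β m F) :
    ∃ w, IsFirstOrderSolution m F w := by
  obtain ⟨hF, heq⟩ := h
  have hFm : ∀ x ∈ Icc (0 : ℝ) 1, F x ∈ Ioo (0 : ℝ) 1 :=
    fun x hx => mem_Ioo_of_mem_increasingC1 hα hβ hF hx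
  have hFpos : ∀ x ∈ Icc (0 : ℝ) 1, 0 < F x * (1 - F x) :=
    fun x hx => mul_pos (hFm x hx).1 (sub_pos.2 (hFm x hx).2)
  have hFc : ContinuousOn F (Icc 0 1) := hF.1.continuousOn
  have hDc := continuousOn_D hF
  have hcc : ContinuousOn (fun y => D F y / (F y * (1 - F y))) (Icc 0 1) :=
    hDc.div (continuousOn_mul_sub hFc) fun x hx => (hFpos x hx).ne'
  set c : ℝ → ℝ := fun x => (m x - F x) * (D F x / (F x * (1 - F x))) with hc
  obtain ⟨K, hK⟩ := isCompact_Icc.exists_bound_of_continuousOn hcc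
  have hcK : ∀ x ∈ Icc (0 : ℝ) 1, |c x| ≤ K := fun x hx => by
    have h1 : |m x - F x| ≤ 1 := by
      have := hm.2 x hx
      have := hFm x hx
      rw [abs_le]
      constructor <;> linarith [this.1, this.2, (hm.2 x hx).1, (hm.2 x hx).2]
    have h2 := hK x hx
    rw [Real.norm_eq_abs] at h2
    rw [hc, abs_mul]
    nlinarith [abs_nonneg (D F x / (F x * (1 - F x)))]
  have hmF : IntervalIntegrable (fun x => m x - F x) volume 0 1 :=
    (intervalIntegrable_of_mem_profiles hm).sub (intervalIntegrable_of_continuousOn hFc)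
  have hDAC : HasACDeriv (D F) (fun x => c x * D F x) := by
    refine .of_primitive ?_ fun x hx => ?_
    · have h2 : ContinuousOn (fun y => D F y / (F y * (1 - F y)) * D F y) (uIcc 0 1) := by
        rw [uIcc_of_le zero_le_one]
        exact hcc.mul hDc
      refine (hmF.mul_continuousOn h2).congr fun x _ => ?_
      simp only [hc]
      ring
    · rw [heq x hx]
      congr 1
      refine intervalIntegral.integral_congr fun y _ => ?_
      simp only [hc]
      ring
  have hDpos : ∀ x ∈ Icc (0 : ℝ) 1, 0 < D F x := by
    intro x hx
    refine lt_of_le_of_ne (D_nonneg hF x) fun h0 => ?_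
    have hz := hDAC.eq_zero_of_abs_deriv_le (K := K) (fun y hy => by
      rw [abs_mul]
      exact mul_le_mul_of_nonneg_right (hcK y hy) (abs_nonneg _)) hx h0.symm
    have h1 := (hasACDeriv_D hF).integral_eq_sub (a := 0) (b := 1) (by simp) (by simp)
    rw [hF.2.2.1, hF.2.2.2, intervalIntegral.integral_congr (g := fun _ => (0 : ℝ))
      (fun y hy => hz y (by rwa [uIcc_of_le zero_le_one] at hy))] at h1
    simp at h1
    linarith
  set w : ℝ → ℝ := fun x => F 0 * (1 - F 0) / D F 0 + ∫ y in (0 : ℝ)..x, (1 - F y - m y) with hw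
  have hwAC : HasACDeriv w (fun x => 1 - F x - m x) :=
    .of_primitive ((intervalIntegrable_of_continuousOn
      (continuousOn_const.sub hFc)).sub (intervalIntegrable_of_mem_profiles hm))
      fun x _ => by simp [hw]
  have h1AC : HasACDeriv (fun _ => 1) (fun _ => 0) :=
    .of_hasDerivWithinAt (fun x _ => hasDerivWithinAt_const ..) continuousOn_const
  have hFAC := hasACDeriv_D hF
  have hP := (hDAC.mul hwAC).sub (hFAC.mul (h1AC.sub hFAC))
  -- `P = F' w - F (1 - F)` satisfies the linear equation `P' = c P`
  have hzero := hP.eq_zero_of_abs_deriv_le (K := K) (x₀ := 0) (fun x hx => ?_) (by simp) ?_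
  · have hDw : ∀ x ∈ Icc (0 : ℝ) 1, D F x * w x = F x * (1 - F x) :=
      fun x hx => sub_eq_zero.1 (hzero x hx)
    have hwpos : ∀ x ∈ Icc (0 : ℝ) 1, 0 < w x := fun x hx => by
      have := hFpos x hx
      rw [← hDw x hx] at this
      exact (mul_pos_iff_of_pos_left (hDpos x hx)).1 this
    refine ⟨w, hFm, hwpos, fun x hx => ?_, fun x _ => by simp [hw]⟩
    rw [← hDw x hx, mul_div_cancel_right₀ _ (hwpos x hx).ne']
    exact hasDerivWithinAt_D hF hx
  · have hne : F x ≠ 0 := (hFm x hx).1.ne'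
    have hne' : 1 - F x ≠ 0 := (sub_pos.2 (hFm x hx).2).ne'
    have hlin : c x * D F x * w x + D F x * (1 - F x - m x)
        - (D F x * (1 - F x) + F x * (0 - D F x)) = c x * (D F x * w x - F x * (1 - F x)) := by
      simp only [hc]
      field_simp
      ring
    simp only [hlin]
    rw [abs_mul]
    exact mul_le_mul_of_nonneg_right (hcK x hx) (abs_nonneg _)
  · simp only [hw, intervalIntegral.integral_same, add_zero]
    rw [mul_div_cancel₀ _ (hDpos 0 (by simp)).ne', sub_self]

/-! ### The extended integral -/

lemma extIntegral_mono {g₁ g₂ : ℝ → EReal} (h : ∀ x ∈ Icc (0 : ℝ) 1, g₁ x ≤ g₂ x) :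
    extIntegral g₁ ≤ extIntegral g₂ := by
  refine EReal.sub_le_sub ?_ ?_ <;> rw [EReal.coe_ennreal_le_coe_ennreal_iff]
  · exact setLIntegral_mono' measurableSet_Icc fun x hx => EReal.toENNReal_le_toENNReal (h x hx)
  · exact setLIntegral_mono' measurableSet_Icc fun x hx =>
      EReal.toENNReal_le_toENNReal (EReal.neg_le_neg_iff.2 (h x hx))

lemma extIntegral_coe {r : ℝ → ℝ} (hr : IntervalIntegrable r volume 0 1) :
    extIntegral (fun x => (r x : EReal)) = ((∫ x in (0 : ℝ)..1, r x : ℝ) : EReal) := by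
  have hr' := (intervalIntegrable_iff_integrableOn_Icc_of_le zero_le_one).1 hr
  rw [intervalIntegral.integral_of_le zero_le_one, ← integral_Icc_eq_integral_Ioc,
    integral_eq_lintegral_pos_part_sub_lintegral_neg_part hr', EReal.coe_sub, extIntegral]
  have h1 : ∫⁻ x in Icc (0 : ℝ) 1, ENNReal.ofReal (r x) ≠ ⊤ := hr'.lintegral_lt_top.ne
  have h2 : ∫⁻ x in Icc (0 : ℝ) 1, ENNReal.ofReal (-r x) ≠ ⊤ := hr'.neg.lintegral_lt_top.ne
  rw [EReal.coe_ennreal_toReal h1, EReal.coe_ennreal_toReal h2]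
  rfl

/-! ### Uniqueness and the variational principle -/

/-- The chemical potential `log (y / (1 - y))`. -/
noncomputable def logit (y : ℝ) : ℝ := Real.log y - Real.log (1 - y)

lemma hasDerivAt_logit {y : ℝ} (hy : y ∈ Ioo (0 : ℝ) 1) :
    HasDerivAt logit (1 / (y * (1 - y))) y := by
  have h0 : y ≠ 0 := hy.1.ne'
  have h1 : 1 - y ≠ 0 := (sub_pos.2 hy.2).ne'
  have := (Real.hasDerivAt_log h0).sub (((hasDerivAt_id y).const_sub 1).log h1)
  refine this.congr_deriv ?_
  simp only [id]
  field_simp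
  ring

lemma strictMonoOn_logit : StrictMonoOn logit (Ioo 0 1) := fun _ hx _ hy hxy =>
  sub_lt_sub (Real.log_lt_log hx.1 hxy)
    (Real.log_lt_log (sub_pos.2 hy.2) (sub_lt_sub_left hxy 1))

lemma HasACDeriv.logit_comp {F d : ℝ → ℝ}
    (hF : ∀ x ∈ Icc (0 : ℝ) 1, HasDerivWithinAt F (d x) (Icc 0 1) x)
    (hd : ContinuousOn d (Icc 0 1)) (hmem : ∀ x ∈ Icc (0 : ℝ) 1, F x ∈ Ioo (0 : ℝ) 1) :
    HasACDeriv (fun x => logit (F x)) (fun x => d x / (F x * (1 - F x))) := by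
  have hFc : ContinuousOn F (Icc 0 1) := fun x hx => (hF x hx).continuousWithinAt
  refine .of_hasDerivWithinAt (fun x hx => ?_) ?_
  · refine ((hasDerivAt_logit (hmem x hx)).comp_hasDerivWithinAt x (hF x hx)).congr_deriv ?_
    ring
  · exact hd.div (continuousOn_mul_sub hFc) fun x hx =>
      (mul_pos (hmem x hx).1 (sub_pos.2 (hmem x hx).2)).ne'

namespace IsFirstOrderSolution

lemma hasACDeriv_logit {m F w : ℝ → ℝ} (h : IsFirstOrderSolution m F w) (hm : m ∈ profiles) :
    HasACDeriv (fun x => logit (F x)) (fun x => 1 / w x) :=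
  (HasACDeriv.logit_comp h.hasDerivWithinAt (h.continuousOn_slope hm) h.mem).congr_deriv
    fun x hx => by
      rw [div_right_comm, div_self (h.mul_sub_pos hx).ne']

/-- The product `(φ₁ - φ₂) (w₁ - w₂)`, with `φ = logit F`, decreases strictly where the two
solutions differ, but vanishes at both end points. -/
theorem eqOn {m F₁ F₂ w₁ w₂ : ℝ → ℝ} (hm : m ∈ profiles) (h₁ : IsFirstOrderSolution m F₁ w₁)
    (h₂ : IsFirstOrderSolution m F₂ w₂) (h0 : F₁ 0 = F₂ 0) (h1 : F₁ 1 = F₂ 1) :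
    EqOn F₁ F₂ (Icc 0 1) := by
  have hP := ((h₁.hasACDeriv_logit hm).sub (h₂.hasACDeriv_logit hm)).mul
    ((h₁.hasACDeriv_w hm).sub (h₂.hasACDeriv_w hm))
  have hφ : ∀ x ∈ Icc (0 : ℝ) 1, 0 ≤ (logit (F₁ x) - logit (F₂ x)) * (F₁ x - F₂ x) := by
    intro x hx
    rcases le_total (F₁ x) (F₂ x) with h | h
    · exact mul_nonneg_of_nonpos_of_nonpos
        (sub_nonpos.2 (strictMonoOn_logit.monotoneOn (h₁.mem x hx) (h₂.mem x hx) h))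
        (sub_nonpos.2 h)
    · exact mul_nonneg
        (sub_nonneg.2 (strictMonoOn_logit.monotoneOn (h₂.mem x hx) (h₁.mem x hx) h))
        (sub_nonneg.2 h)
  have hw : ∀ x ∈ Icc (0 : ℝ) 1, (1 / w₁ x - 1 / w₂ x) * (w₁ x - w₂ x) ≤ 0 := by
    intro x hx
    have e1 := h₁.pos x hx
    have e2 := h₂.pos x hx
    have : (1 / w₁ x - 1 / w₂ x) * (w₁ x - w₂ x) = -((w₁ x - w₂ x) ^ 2 / (w₁ x * w₂ x)) := by
      field_simp
      ring
    rw [this, neg_nonpos]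
    positivity
  have hanti := hP.antitoneOn (.of_forall fun x hx => by
    have a1 := hφ x hx
    have a2 := hw x hx
    linarith)
  have hzero : ∀ x ∈ Icc (0 : ℝ) 1,
      (logit (F₁ x) - logit (F₂ x)) * (w₁ x - w₂ x) = 0 := fun x hx => by
    have a1 := hanti (show (0 : ℝ) ∈ Icc 0 1 by simp) hx hx.1
    have a2 := hanti hx (show (1 : ℝ) ∈ Icc 0 1 by simp) hx.2
    simp only [h0, h1, sub_self, zero_mul] at a1 a2
    exact le_antisymm a1 a2
  refine Measure.eqOn_Icc_of_ae_eq volume zero_ne_one ?_ h₁.continuousOn h₂.continuousOn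
  rw [Filter.EventuallyEq, ae_restrict_iff' measurableSet_Icc]
  filter_upwards [hP.ae, ae_mem_Ioo] with x hx hx' hxI
  have hd : HasDerivAt (fun x => (logit (F₁ x) - logit (F₂ x)) * (w₁ x - w₂ x)) 0 x := by
    refine (hasDerivAt_const x (0 : ℝ)).congr_of_eventuallyEq ?_
    filter_upwards [Icc_mem_nhds (hx' hxI).1 (hx' hxI).2] with y hy
    exact hzero y hy
  have he := (hx hxI).unique hd
  have a1 := hφ x hxI
  have a2 := hw x hxI
  have a3 : (logit (F₁ x) - logit (F₂ x)) * (F₁ x - F₂ x) = 0 := by linarith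
  rcases mul_eq_zero.1 a3 with h | h
  · exact strictMonoOn_logit.injOn (h₁.mem x hxI) (h₂.mem x hxI) (sub_eq_zero.1 h)
  · exact sub_eq_zero.1 h

end IsFirstOrderSolution

/-- The integrand of `𝒢(m, F)` as a real number, which is correct where `F' > 0`. -/
noncomputable def density (α β : ℝ) (m F : ℝ → ℝ) (x : ℝ) : ℝ :=
  -(m x * Real.log (F x) + (1 - m x) * Real.log (1 - F x))
    + if α = β then 0 else Real.log (D F x / (β - α))

lemma coe_density_eq {α β : ℝ} {m F : ℝ → ℝ} {x : ℝ} (hαβ : α ≤ β) (hD : α < β → 0 < D F x) :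
    ((density α β m F x : ℝ) : EReal)
      = ((-(m x * Real.log (F x) + (1 - m x) * Real.log (1 - F x)) : ℝ) : EReal)
        + logSlope α β F x := by
  rw [density, logSlope, EReal.coe_add]
  congr 1
  split_ifs with h
  · rfl
  · have hlt := lt_of_le_of_ne hαβ h
    rw [ENNReal.log_ofReal_of_pos (div_pos (hD hlt) (sub_pos.2 hlt))]

lemma intervalIntegrable_density {α β : ℝ} {m F : ℝ → ℝ} (hα : 0 < α) (hαβ : α ≤ β) (hβ : β < 1)
    (hm : m ∈ profiles) (hF : F ∈ increasingC1 α β)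
    (hD : α < β → ∀ x ∈ Icc (0 : ℝ) 1, 0 < D F x) :
    IntervalIntegrable (density α β m F) volume 0 1 := by
  have hFm : ∀ x ∈ Icc (0 : ℝ) 1, F x ∈ Ioo (0 : ℝ) 1 :=
    fun x hx => mem_Ioo_of_mem_increasingC1 hα hβ hF hx
  have hFc : ContinuousOn F (Icc 0 1) := hF.1.continuousOn
  have hl1 : ContinuousOn (fun x => Real.log (F x)) (Icc 0 1) :=
    hFc.log fun x hx => (hFm x hx).1.ne'
  have hl2 : ContinuousOn (fun x => Real.log (1 - F x)) (Icc 0 1) :=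
    (continuousOn_const.sub hFc).log fun x hx => (sub_pos.2 (hFm x hx).2).ne'
  have hl3 : ContinuousOn (fun x => if α = β then 0 else Real.log (D F x / (β - α)))
      (Icc 0 1) := by
    split_ifs with h
    · exact continuousOn_const
    · have hlt := lt_of_le_of_ne hαβ h
      exact ((continuousOn_D hF).div_const _).log fun x hx =>
        (div_pos (hD hlt x hx) (sub_pos.2 hlt)).ne'
  have hl4 : ContinuousOn (fun x => Real.log (1 - F x) - Real.log (F x)) (uIcc 0 1) := by
    rw [uIcc_of_le zero_le_one]
    exact hl2.sub hl1
  refine (((intervalIntegrable_of_mem_profiles hm).mul_continuousOn hl4).add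
    (intervalIntegrable_of_continuousOn (hl3.sub hl2))).congr fun x _ => ?_
  simp only [density, Pi.sub_apply]
  ring

lemma G_eq_integral_density {α β : ℝ} {m F : ℝ → ℝ} (hα : 0 < α) (hαβ : α ≤ β) (hβ : β < 1)
    (hm : m ∈ profiles) (hF : F ∈ increasingC1 α β)
    (hD : α < β → ∀ x ∈ Icc (0 : ℝ) 1, 0 < D F x) :
    G α β m F = ((∫ x in (0 : ℝ)..1, density α β m F x : ℝ) : EReal) := by
  rw [← extIntegral_coe (intervalIntegrable_density hα hαβ hβ hm hF hD), G]
  refine le_antisymm (extIntegral_mono fun x hx => ?_) (extIntegral_mono fun x hx => ?_) <;>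
  rw [coe_density_eq hαβ fun h => hD h x hx]

lemma eqOn_const_of_mem_increasingC1 {α : ℝ} {F : ℝ → ℝ} (hF : F ∈ increasingC1 α α) :
    EqOn F (fun _ => α) (Icc 0 1) := fun x hx => by
  simpa using mem_Icc_of_mem_increasingC1 hF hx

lemma G_congr {α β : ℝ} {m F₁ F₂ : ℝ → ℝ} (h : EqOn F₁ F₂ (Icc 0 1)) :
    G α β m F₁ = G α β m F₂ := by
  refine le_antisymm (extIntegral_mono fun x hx => ?_) (extIntegral_mono fun x hx => ?_) <;>
  simp only [h hx, logSlope, D_congr h hx, le_refl]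

/-- The pointwise tangent line inequality for the functional `𝒢(m, ·)`, which is concave in
`logit F`. -/
lemma log_tangent_le {m f h d w k : ℝ} (hf : f ∈ Ioo (0 : ℝ) 1) (hh : h ∈ Ioo (0 : ℝ) 1)
    (hd : 0 < d) (hw : 0 < w) (hk : 0 < k) :
    -(m * Real.log h + (1 - m) * Real.log (1 - h)) + Real.log (d / k)
      ≤ -(m * Real.log f + (1 - m) * Real.log (1 - f)) + Real.log (f * (1 - f) / w / k)
        + ((1 - f - m) * (logit h - logit f) + w * (d / (h * (1 - h)) - 1 / w)) := by
  have hf0 := hf.1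
  have hf1 := sub_pos.2 hf.2
  have hh0 := hh.1
  have hh1 := sub_pos.2 hh.2
  have e1 : Real.log (d / k) = Real.log d - Real.log k := Real.log_div hd.ne' hk.ne'
  have e2 : Real.log (f * (1 - f) / w / k)
      = Real.log f + Real.log (1 - f) - Real.log w - Real.log k := by
    rw [Real.log_div (by positivity) hk.ne', Real.log_div (by positivity) hw.ne',
      Real.log_mul hf0.ne' hf1.ne']
  -- concavity of `log` at the slope of `logit h`
  have e3 := Real.log_le_sub_one_of_pos (show 0 < d / (h * (1 - h)) * w by positivity)
  rw [Real.log_mul (by positivity) hw.ne', Real.log_div hd.ne' (by positivity),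
    Real.log_mul hh0.ne' hh1.ne'] at e3
  have e4 : w * (d / (h * (1 - h)) - 1 / w) = d / (h * (1 - h)) * w - 1 := by
    field_simp
  -- Gibbs' inequality for the Bernoulli measures of means `f` and `h`
  have e5 := Real.log_le_sub_one_of_pos (div_pos hh0 hf0)
  have e6 := Real.log_le_sub_one_of_pos (div_pos hh1 hf1)
  rw [Real.log_div hh0.ne' hf0.ne'] at e5
  rw [Real.log_div hh1.ne' hf1.ne'] at e6
  have e7 : f * (Real.log h - Real.log f) + (1 - f) * (Real.log (1 - h) - Real.log (1 - f))
      ≤ 0 := by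
    have a1 := mul_le_mul_of_nonneg_left e5 hf0.le
    have a2 := mul_le_mul_of_nonneg_left e6 hf1.le
    have a3 : f * (h / f - 1) = h - f := by field_simp
    have a4 : (1 - f) * ((1 - h) / (1 - f) - 1) = f - h := by
      field_simp
      ring
    linarith
  rw [e1, e2, e4, logit, logit]
  nlinarith [e3, e7]

/-- The solution of the boundary value problem maximizes `𝒢(m, ·)`: integrating the tangent
line inequality leaves `∫ (w η)' = 0` for `η = logit H - logit F`. -/
theorem IsFirstOrderSolution.G_le {α β : ℝ} {m F w H : ℝ → ℝ} (hα : 0 < α) (hαβ : α < β)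
    (hβ : β < 1) (hm : m ∈ profiles) (hF : F ∈ increasingC1 α β) (h : IsFirstOrderSolution m F w)
    (hH : H ∈ increasingC1 α β) : G α β m H ≤ G α β m F := by
  have hHm : ∀ x ∈ Icc (0 : ℝ) 1, H x ∈ Ioo (0 : ℝ) 1 :=
    fun x hx => mem_Ioo_of_mem_increasingC1 hα hβ hH hx
  have hD : α < β → ∀ x ∈ Icc (0 : ℝ) 1, 0 < D F x := fun _ x hx => by
    rw [h.D_eq hx]
    exact h.slope_pos hx
  have hη := ((HasACDeriv.logit_comp (fun x hx => hasDerivWithinAt_D hH hx) (continuousOn_D hH)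
    hHm).sub (h.hasACDeriv_logit hm))
  have hP := (h.hasACDeriv_w hm).mul hη
  have hPint := hP.integral_eq_sub (a := 0) (b := 1) (by simp) (by simp)
  simp only [hF.2.2.1, hF.2.2.2, hH.2.2.1, hH.2.2.2, sub_self, mul_zero] at hPint
  have hFi := intervalIntegrable_density hα hαβ.le hβ hm hF hD
  rw [G_eq_integral_density hα hαβ.le hβ hm hF hD]
  have hsum := intervalIntegral.integral_add hFi hP.intervalIntegrable
  rw [hPint, add_zero] at hsum
  rw [← hsum, ← extIntegral_coe (hFi.add hP.intervalIntegrable)]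
  refine extIntegral_mono fun x hx => ?_
  rcases (D_nonneg hH x).eq_or_lt with h0 | hpos
  · rw [logSlope, if_neg hαβ.ne, ← h0]
    simp
  · rw [← coe_density_eq hαβ.le fun _ => hpos, EReal.coe_le_coe_iff, density, density,
      if_neg hαβ.ne, if_neg hαβ.ne, h.D_eq hx]
    exact log_tangent_le (h.mem x hx) (hHm x hx) hpos (h.pos x hx) (sub_pos.2 hαβ)

theorem IsBVPSolution.G_le {α β : ℝ} {m F H : ℝ → ℝ} (hα : 0 < α) (hαβ : α ≤ β)
    (hβ : β < 1) (hm : m ∈ profiles) (h : IsBVPSolution α β m F)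
    (hH : H ∈ increasingC1 α β) : G α β m H ≤ G α β m F := by
  rcases hαβ.eq_or_lt with rfl | hlt
  · rw [G_congr ((eqOn_const_of_mem_increasingC1 hH).trans
      (eqOn_const_of_mem_increasingC1 h.1).symm)]
  · obtain ⟨w, hw⟩ := h.exists_isFirstOrderSolution hα hlt hβ hm
    exact hw.G_le hα hlt hβ hm h.1 hH

theorem IsBVPSolution.eqOn {α β : ℝ} {m F₁ F₂ : ℝ → ℝ} (hα : 0 < α) (hαβ : α ≤ β)
    (hβ : β < 1) (hm : m ∈ profiles) (h₁ : IsBVPSolution α β m F₁)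
    (h₂ : IsBVPSolution α β m F₂) : EqOn F₁ F₂ (Icc 0 1) := by
  rcases hαβ.eq_or_lt with rfl | hlt
  · exact (eqOn_const_of_mem_increasingC1 h₁.1).trans (eqOn_const_of_mem_increasingC1 h₂.1).symm
  · obtain ⟨w₁, hw₁⟩ := h₁.exists_isFirstOrderSolution hα hlt hβ hm
    obtain ⟨w₂, hw₂⟩ := h₂.exists_isFirstOrderSolution hα hlt hβ hm
    exact hw₁.eqOn hm hw₂ (h₁.1.2.2.1.trans h₂.1.2.2.1.symm) (h₁.1.2.2.2.trans h₂.1.2.2.2.symm)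

lemma intervalIntegrable_s_comp {m : ℝ → ℝ} (hm : m ∈ profiles) :
    IntervalIntegrable (fun x => s (m x)) volume 0 1 := by
  have hs : Continuous s :=
    Real.continuous_mul_log.add (Real.continuous_mul_log.comp (continuous_const.sub continuous_id))
  obtain ⟨C, hC⟩ := (isCompact_Icc (a := (0 : ℝ)) (b := 1)).exists_bound_of_continuousOn
    hs.continuousOn
  rw [intervalIntegrable_iff_integrableOn_Icc_of_le zero_le_one]
  refine Integrable.of_bound (hs.measurable.comp_aemeasurable hm.1).aestronglyMeasurable C ?_
  rw [ae_restrict_iff' measurableSet_Icc]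
  exact .of_forall fun x hx => hC _ (hm.2 x hx)

/-- `V(m) + 𝕊(m) = 𝒢(m, F)` for the solution `F` of the boundary value problem. -/
theorem IsBVPSolution.coe_V_add_S {α β : ℝ} {m F : ℝ → ℝ} (hα : 0 < α) (hαβ : α ≤ β)
    (hβ : β < 1) (hm : m ∈ profiles) (h : IsBVPSolution α β m F) :
    ((V α β m + S m : ℝ) : EReal) = G α β m F := by
  have hsol : IsBVPSolution α β m (bvpSolution α β m) := Classical.epsilon_spec ⟨F, h⟩
  rw [G_congr (h.eqOn hα hαβ hβ hm hsol)]
  set K := bvpSolution α β m with hK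
  have hD : α < β → ∀ x ∈ Icc (0 : ℝ) 1, 0 < D K x := fun hlt x hx => by
    obtain ⟨w, hw⟩ := hsol.exists_isFirstOrderSolution hα hlt hβ hm
    rw [hw.D_eq hx]
    exact hw.slope_pos hx
  have hi := intervalIntegrable_density hα hαβ hβ hm hsol.1 hD
  have hV : V α β m = ∫ x in (0 : ℝ)..1, (density α β m K x + s (m x)) := by
    refine intervalIntegral.integral_congr fun x hx => ?_
    rw [uIcc_of_le zero_le_one] at hx
    have hKx := mem_Ioo_of_mem_increasingC1 hα hβ hsol.1 hx
    have hlog : ∀ a b : ℝ, b ≠ 0 → a * Real.log (a / b) = a * Real.log a - a * Real.log b := by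
      intro a b hb
      rcases eq_or_ne a 0 with rfl | ha
      · simp
      · rw [Real.log_div ha hb]
        ring
    simp only [← hK, density, s, hlog _ _ hKx.1.ne', hlog _ _ (sub_pos.2 hKx.2).ne']
    ring
  rw [G_eq_integral_density hα hαβ hβ hm hsol.1 hD, hV, S,
    intervalIntegral.integral_add hi (intervalIntegrable_s_comp hm), add_neg_cancel_right]

/-! ### Saddle points -/

lemma step_mem_profiles (x₀ : ℝ) : step x₀ ∈ profiles := by
  refine ⟨(measurable_const.indicator measurableSet_Icc).aemeasurable, fun x _ => ?_⟩
  rw [step, indicator_apply]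
  split_ifs <;> simp

lemma step_of_lt {x₀ x : ℝ} (h : x < x₀) : step x₀ x = 0 :=
  indicator_of_notMem (fun hx => h.not_ge hx.1) _

lemma step_of_le {x₀ x : ℝ} (h : x₀ ≤ x) (hx : x ≤ 1) : step x₀ x = 1 :=
  indicator_of_mem (show x ∈ Icc x₀ 1 from ⟨h, hx⟩) _

/-- `(𝟏{[x₀, 1]}, F)` is a saddle point of `𝒢` with value `E₋`. That `F` maximizes
`𝒢(𝟏{[x₀, 1]}, ·)` is expressed by the boundary value problem. -/
structure IsSaddlePoint (α β x₀ : ℝ) (F : ℝ → ℝ) : Prop where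
  mem : x₀ ∈ Icc (0 : ℝ) 1
  isBVPSolution : IsBVPSolution α β (step x₀) F
  G_eq : G α β (step x₀) F = ((Eminus α β : ℝ) : EReal)
  le_G : ∀ m ∈ profiles, ((Eminus α β : ℝ) : EReal) ≤ G α β m F

/-- `𝒢(·, F)` is minimized by `𝟏{F ≥ 1/2}`. If the minimal integrand is constant, its value is
`E₋`. -/
theorem isSaddlePoint_of_density {α β x₀ : ℝ} {F : ℝ → ℝ} (hα : 0 < α) (hαβ : α ≤ β) (hβ : β < 1)
    (hx₀ : x₀ ∈ Icc (0 : ℝ) 1) (hF : IsBVPSolution α β (step x₀) F)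
    (hD : α < β → ∀ x ∈ Icc (0 : ℝ) 1, 0 < D F x)
    (hlt : ∀ x ∈ Ioo (0 : ℝ) 1, x < x₀ → F x ≤ 1 / 2)
    (hge : ∀ x ∈ Ioo (0 : ℝ) 1, x₀ ≤ x → 1 / 2 ≤ F x)
    (hE : ∀ x ∈ Ioo (0 : ℝ) 1, -Real.log (max (F x) (1 - F x))
      + (if α = β then 0 else Real.log (D F x / (β - α))) = Eminus α β) :
    IsSaddlePoint α β x₀ F := by
  refine ⟨hx₀, hF, ?_, fun m hm => ?_⟩
  · rw [G_eq_integral_density hα hαβ hβ (step_mem_profiles x₀) hF.1 hD]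
    have : ∫ x in (0 : ℝ)..1, density α β (step x₀) F x = ∫ x in (0 : ℝ)..1, Eminus α β := by
      refine intervalIntegral.integral_congr_ae ?_
      filter_upwards [ae_mem_Ioo] with x hx hxI
      rw [uIoc_of_le zero_le_one] at hxI
      have hx' := hx (Ioc_subset_Icc_self hxI)
      rw [← hE x hx', density]
      rcases lt_or_ge x x₀ with h | h
      · rw [step_of_lt h, max_eq_right (by linarith [hlt x hx' h])]
        simp
      · rw [step_of_le h hx'.2.le, max_eq_left (by linarith [hge x hx' h])]
        simp
    rw [this]
    simp
  · rw [G_eq_integral_density hα hαβ hβ hm hF.1 hD, EReal.coe_le_coe_iff]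
    have hc : ∫ x in (0 : ℝ)..1, Eminus α β = Eminus α β := by simp
    rw [← hc]
    refine intervalIntegral.integral_mono_on_of_le_Ioo zero_le_one (by simp)
      (intervalIntegrable_density hα hαβ hβ hm hF.1 hD) fun x hx => ?_
    have hxI := Ioo_subset_Icc_self hx
    obtain ⟨hF0, hF1⟩ := mem_Ioo_of_mem_increasingC1 hα hβ hF.1 hxI
    obtain ⟨hm0, hm1⟩ := hm.2 x hxI
    rw [← hE x hx, density]
    have h1 := mul_le_mul_of_nonneg_left
      (Real.log_le_log hF0 (le_max_left (F x) (1 - F x))) hm0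
    have h2 := mul_le_mul_of_nonneg_left
      (Real.log_le_log (sub_pos.2 hF1) (le_max_right (F x) (1 - F x))) (sub_nonneg.2 hm1)
    linarith

namespace IsSaddlePoint

variable {α β x₀ : ℝ} {F : ℝ → ℝ}

lemma V_add_S_step (h : IsSaddlePoint α β x₀ F) (hα : 0 < α) (hαβ : α ≤ β) (hβ : β < 1) :
    V α β (step x₀) + S (step x₀) = Eminus α β := by
  have := h.isBVPSolution.coe_V_add_S hα hαβ hβ (step_mem_profiles x₀)
  rw [h.G_eq] at this
  exact_mod_cast this

lemma le_V_add_S (h : IsSaddlePoint α β x₀ F) (hα : 0 < α) (hαβ : α ≤ β) (hβ : β < 1)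
    {m H : ℝ → ℝ} (hm : m ∈ profiles) (hH : IsBVPSolution α β m H) :
    Eminus α β ≤ V α β m + S m := by
  rw [← EReal.coe_le_coe_iff, hH.coe_V_add_S hα hαβ hβ hm]
  exact (h.le_G m hm).trans (hH.G_le hα hαβ hβ hm h.isBVPSolution.1)

lemma iInf_iSup_G (h : IsSaddlePoint α β x₀ F) (hα : 0 < α) (hαβ : α ≤ β) (hβ : β < 1) :
    (⨅ m ∈ profiles, ⨆ H ∈ increasingC1 α β, G α β m H) = ((Eminus α β : ℝ) : EReal) := by
  refine le_antisymm ?_ (le_iInf₂ fun m hm => ?_)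
  · refine (iInf₂_le (step x₀) (step_mem_profiles x₀)).trans (iSup₂_le fun H hH => ?_)
    exact (h.isBVPSolution.G_le hα hαβ hβ (step_mem_profiles x₀) hH).trans_eq h.G_eq
  · exact (h.le_G m hm).trans (le_iSup₂ (f := fun H _ => G α β m H) F h.isBVPSolution.1)

lemma iSup_iInf_G (h : IsSaddlePoint α β x₀ F) (hα : 0 < α) (hαβ : α ≤ β) (hβ : β < 1) :
    (⨆ H ∈ increasingC1 α β, ⨅ m ∈ profiles, G α β m H) = ((Eminus α β : ℝ) : EReal) := by
  refine le_antisymm (iSup₂_le fun H hH => ?_) ?_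
  · refine (iInf₂_le (step x₀) (step_mem_profiles x₀)).trans ?_
    exact (h.isBVPSolution.G_le hα hαβ hβ (step_mem_profiles x₀) hH).trans_eq h.G_eq
  · exact (le_iInf₂ h.le_G).trans
      (le_iSup₂ (f := fun H _ => ⨅ m ∈ profiles, G α β m H) F h.isBVPSolution.1)

end IsSaddlePoint

/-! ### The equilibrium case -/

lemma isBVPSolution_const (α : ℝ) (m : ℝ → ℝ) : IsBVPSolution α α m (fun _ => α) := by
  have hD : ∀ x, D (fun _ => α) x = 0 := fun x => by simp [D]
  exact ⟨⟨contDiffOn_const, monotoneOn_const, rfl, rfl⟩, fun x _ => by simp [hD]⟩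

lemma isSaddlePoint_const {α x₀ : ℝ} (hα : 0 < α) (hβ : α < 1) (hx₀ : x₀ ∈ Icc (0 : ℝ) 1)
    (hlt : ∀ x ∈ Ioo (0 : ℝ) 1, x < x₀ → α ≤ 1 / 2)
    (hge : ∀ x ∈ Ioo (0 : ℝ) 1, x₀ ≤ x → 1 / 2 ≤ α) :
    IsSaddlePoint α α x₀ (fun _ => α) :=
  isSaddlePoint_of_density hα le_rfl hβ hx₀ (isBVPSolution_const α _)
    (fun h => (lt_irrefl α h).elim) hlt hge fun x _ => by simp [Eminus]

/-! ### The optimal density -/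

/-- The solution of `h' = max h (1 - h)`, `h 0 = 1/2`. -/
noncomputable def optCurve (t : ℝ) : ℝ := 1 / 2 + ∫ u in (0 : ℝ)..t, Real.exp |u| / 2

/-- The inverse of `optCurve`. -/
noncomputable def optTime (y : ℝ) : ℝ :=
  if y ≤ 1 / 2 then -Real.log (2 * (1 - y)) else Real.log (2 * y)

lemma hasDerivAt_optCurve (t : ℝ) : HasDerivAt optCurve (Real.exp |t| / 2) t := by
  have hc : Continuous fun u : ℝ => Real.exp |u| / 2 := by fun_prop
  exact (hc.integral_hasStrictDerivAt 0 t).hasDerivAt.const_add _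

lemma optCurve_of_nonneg {t : ℝ} (ht : 0 ≤ t) : optCurve t = Real.exp t / 2 := by
  have : ∫ u in (0 : ℝ)..t, Real.exp |u| / 2 = ∫ u in (0 : ℝ)..t, Real.exp u / 2 := by
    refine intervalIntegral.integral_congr fun u hu => ?_
    rw [uIcc_of_le ht] at hu
    simp only [abs_of_nonneg hu.1]
  rw [optCurve, this, intervalIntegral.integral_div, integral_exp, Real.exp_zero]
  ring

lemma optCurve_of_nonpos {t : ℝ} (ht : t ≤ 0) : optCurve t = 1 - Real.exp (-t) / 2 := by
  have : ∫ u in (0 : ℝ)..t, Real.exp |u| / 2 = ∫ u in (0 : ℝ)..t, Real.exp (-u) / 2 := by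
    refine intervalIntegral.integral_congr fun u hu => ?_
    rw [uIcc_of_ge ht] at hu
    simp only [abs_of_nonpos hu.2]
  rw [optCurve, this, intervalIntegral.integral_div, intervalIntegral.integral_comp_neg,
    integral_exp, neg_zero, Real.exp_zero]
  ring

lemma max_optCurve (t : ℝ) : max (optCurve t) (1 - optCurve t) = Real.exp |t| / 2 := by
  rcases le_total 0 t with h | h
  · have := Real.one_le_exp h
    rw [optCurve_of_nonneg h, abs_of_nonneg h, max_eq_left (by linarith)]
  · have := Real.one_le_exp (neg_nonneg.2 h)
    rw [optCurve_of_nonpos h, abs_of_nonpos h, max_eq_right (by linarith)]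
    ring

lemma optCurve_mul_sub (t : ℝ) :
    optCurve t * (1 - optCurve t) = Real.exp |t| / 2 * (1 - Real.exp |t| / 2) := by
  rcases le_total 0 t with h | h
  · rw [optCurve_of_nonneg h, abs_of_nonneg h]
  · rw [optCurve_of_nonpos h, abs_of_nonpos h]
    ring

lemma strictMono_optCurve : StrictMono optCurve :=
  strictMono_of_deriv_pos fun t => by
    rw [(hasDerivAt_optCurve t).deriv]
    positivity

lemma optCurve_optTime (y : ℝ) : optCurve (optTime y) = y := by
  rw [optTime]
  split_ifs with h
  · have h1 : 0 ≤ Real.log (2 * (1 - y)) := Real.log_nonneg (by linarith)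
    rw [optCurve_of_nonpos (by linarith), neg_neg, Real.exp_log (by linarith)]
    ring
  · rw [not_le] at h
    rw [optCurve_of_nonneg (Real.log_nonneg (by linarith)), Real.exp_log (by linarith)]
    ring

lemma optTime_of_ge {y : ℝ} (hy : 1 / 2 ≤ y) : optTime y = Real.log (2 * y) := by
  rw [optTime]
  split_ifs with h
  · have : y = 1 / 2 := le_antisymm h hy
    norm_num [this]
  · rfl

/-- The maximizer of `inf_m 𝒢(m, F)` is the solution of `F' = κ max F (1 - F)` with
`κ = optTime β - optTime α`; it crosses `1/2` at `x₀`. -/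
theorem isSaddlePoint_optCurve {α β x₀ : ℝ} (hα : 0 < α) (hαβ : α < β) (hβ : β < 1)
    (hx₀ : x₀ ∈ Icc (0 : ℝ) 1)
    (hlt : ∀ x ∈ Ioo (0 : ℝ) 1, x < x₀ → optTime α + (optTime β - optTime α) * x ≤ 0)
    (hge : ∀ x ∈ Ioo (0 : ℝ) 1, x₀ ≤ x → 0 ≤ optTime α + (optTime β - optTime α) * x) :
    IsSaddlePoint α β x₀ (fun x => optCurve (optTime α + (optTime β - optTime α) * x)) := by
  set κ := optTime β - optTime α with hκ
  set L : ℝ → ℝ := fun x => optTime α + κ * x with hL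
  set F : ℝ → ℝ := fun x => optCurve (L x) with hF
  have hcα : optCurve (optTime α) = α := optCurve_optTime α
  have hcβ : optCurve (optTime β) = β := optCurve_optTime β
  have hκ0 : 0 < κ := by
    rw [hκ, sub_pos, ← strictMono_optCurve.lt_iff_lt, hcα, hcβ]
    exact hαβ
  have hF0 : F 0 = α := by simp [hF, hL, hcα]
  have hF1 : F 1 = β := by simp [hF, hL, hκ, hcβ]
  have hLd : ∀ x, HasDerivAt L κ x := fun x => by
    simpa only [mul_one] using! ((hasDerivAt_id x).const_mul κ).const_add (optTime α)
  have hLc : Continuous L := by fun_prop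
  have hFd : ∀ x, HasDerivAt F (Real.exp |L x| / 2 * κ) x := fun x =>
    (hasDerivAt_optCurve (L x)).comp x (hLd x)
  have hFdc : Continuous fun x => Real.exp |L x| / 2 * κ := by fun_prop
  have hFmono : StrictMono F := fun x y hxy =>
    strictMono_optCurve (by simp only [hL]; nlinarith)
  have hFmem : ∀ x ∈ Icc (0 : ℝ) 1, F x ∈ Ioo (0 : ℝ) 1 := fun x hx =>
    ⟨hα.trans_le (hF0 ▸ hFmono.monotone hx.1), (hF1 ▸ hFmono.monotone hx.2).trans_lt hβ⟩
  have hmax : ∀ x, max (F x) (1 - F x) = Real.exp |L x| / 2 := fun x => max_optCurve (L x)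
  set w : ℝ → ℝ := fun x => (1 - Real.exp |L x| / 2) / κ with hw
  have hwc : Continuous w := by fun_prop
  have hwpos : ∀ x ∈ Icc (0 : ℝ) 1, 0 < w x := fun x hx => by
    refine div_pos ?_ hκ0
    rw [← hmax x, sub_pos, max_lt_iff]
    exact ⟨(hFmem x hx).2, by linarith [(hFmem x hx).1]⟩
  have hslope : ∀ x ∈ Icc (0 : ℝ) 1, F x * (1 - F x) / w x = Real.exp |L x| / 2 * κ := by
    intro x hx
    rw [div_eq_iff (hwpos x hx).ne']
    simp only [hF, optCurve_mul_sub, hw]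
    field_simp
  have hsol : IsFirstOrderSolution (step x₀) F w := by
    refine ⟨hFmem, hwpos, fun x hx => ?_, fun x hx => ?_⟩
    · rw [hslope x hx]
      exact (hFd x).hasDerivWithinAt
    · have hFc : Continuous F := continuous_iff_continuousAt.2 fun x => (hFd x).continuousAt
      have hi : IntervalIntegrable (fun y => 1 - F y - step x₀ y) volume 0 1 :=
        (intervalIntegrable_of_continuousOn (by fun_prop)).sub
          (intervalIntegrable_of_mem_profiles (step_mem_profiles x₀))
      have hi' := hi.mono_set (c := 0) (d := x) (by
        rw [uIcc_of_le zero_le_one, uIcc_of_le hx.1]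
        exact Icc_subset_Icc_right hx.2)
      -- the kink of `w` sits at the zero of `L`
      rw [integral_eq_of_hasDerivAt_off_countable_of_le w _ hx.1
        (countable_singleton (-optTime α / κ)) hwc.continuousOn (fun y hy => ?_) hi']
      · ring
      have hy01 : y ∈ Ioo (0 : ℝ) 1 := ⟨hy.1.1, hy.1.2.trans_le hx.2⟩
      have hLy : L y ≠ 0 := fun h0 => hy.2 <| by
        rw [mem_singleton_iff, eq_div_iff hκ0.ne']
        simp only [hL] at h0
        linarith
      rcases lt_or_ge y x₀ with h | h
      · have hneg : L y < 0 := lt_of_le_of_ne (hlt y hy01 h) hLy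
        have hd := (((((hasDerivAt_abs_neg hneg).comp y (hLd y)).exp).div_const 2).const_sub
          1).div_const κ
        refine hd.congr_deriv ?_
        simp only [hF, step_of_lt h, optCurve_of_nonpos hneg.le, Function.comp,
          abs_of_neg hneg]
        field_simp
        ring
      · have hpos : 0 < L y := lt_of_le_of_ne (hge y hy01 h) hLy.symm
        have hd := (((((hasDerivAt_abs_pos hpos).comp y (hLd y)).exp).div_const 2).const_sub
          1).div_const κ
        refine hd.congr_deriv ?_
        simp only [hF, step_of_le h hy01.2.le, optCurve_of_nonneg hpos.le, Function.comp,
          abs_of_pos hpos]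
        field_simp
        ring
  have hDF : ∀ x ∈ Icc (0 : ℝ) 1, D F x = Real.exp |L x| / 2 * κ := fun x hx =>
    D_eq_of_hasDerivWithinAt hx (hFd x).hasDerivWithinAt
  have hE : Eminus α β = Real.log (κ / (β - α)) := by
    have hint : ∫ y in α..β, 1 / max y (1 - y) = κ := by
      have hg : Continuous fun y : ℝ => 1 / max y (1 - y) := by
        refine continuous_const.div (by fun_prop) fun y => ?_
        rcases le_total y (1 / 2) with h | h
        · exact (lt_max_of_lt_right (by linarith)).ne'
        · exact (lt_max_of_lt_left (by linarith)).ne'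
      have h := intervalIntegral.integral_comp_mul_deriv (a := 0) (b := 1)
        (fun x _ => hFd x) hFdc.continuousOn hg
      rw [hF0, hF1] at h
      rw [← h]
      have : ∀ x, ((fun y : ℝ => 1 / max y (1 - y)) ∘ F) x * (Real.exp |L x| / 2 * κ) = κ := by
        intro x
        simp only [Function.comp, hmax]
        field_simp
      simp only [this, intervalIntegral.integral_const, sub_zero, one_smul]
    rw [Eminus, if_neg hαβ.ne, hint, one_div_mul_eq_div]
  refine isSaddlePoint_of_density hα hαβ.le hβ hx₀
    (hsol.isBVPSolution (step_mem_profiles x₀) hF0 hF1) (fun _ x hx => ?_) (fun x hx h => ?_)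
    (fun x hx h => ?_) fun x hx => ?_
  · rw [hDF x hx]
    positivity
  · have h1 := strictMono_optCurve.monotone (hlt x hx h)
    rw [optCurve_of_nonneg le_rfl, Real.exp_zero] at h1
    exact h1
  · have h1 := strictMono_optCurve.monotone (hge x hx h)
    rw [optCurve_of_nonneg le_rfl, Real.exp_zero] at h1
    exact h1
  · have hβα := sub_pos.2 hαβ
    rw [if_neg hαβ.ne, hE, hDF x (Ioo_subset_Icc_self hx), hmax, mul_div_assoc,
      Real.log_mul (by positivity) (by positivity)]
    ring

/-! ### Existence for the boundary value problem -/

lemma abs_sigmoid_sub_le (p q : ℝ) : |Real.sigmoid p - Real.sigmoid q| ≤ |p - q| := by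
  have h : LipschitzWith 1 Real.sigmoid := by
    refine lipschitzWith_of_nnnorm_deriv_le differentiable_sigmoid fun x => ?_
    rw [← NNReal.coe_le_coe, coe_nnnorm, Real.deriv_sigmoid, Real.norm_eq_abs, abs_le]
    have h0 := Real.sigmoid_pos x
    have h1 := Real.sigmoid_lt_one x
    constructor <;> push_cast <;> nlinarith
  simpa [Real.dist_eq] using h.dist_le_mul p q

lemma abs_one_div_max_sub_le {ε : ℝ} (hε : 0 < ε) (p q : ℝ) :
    |1 / max p ε - 1 / max q ε| ≤ 1 / ε ^ 2 * |p - q| := by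
  have hp : ε ≤ max p ε := le_max_right _ _
  have hq : ε ≤ max q ε := le_max_right _ _
  have hp0 := hε.trans_le hp
  have hq0 := hε.trans_le hq
  have h1 : 1 / max p ε - 1 / max q ε = 1 / (max p ε * max q ε) * (max q ε - max p ε) := by
    field_simp
  rw [h1, abs_mul, abs_of_pos (by positivity), abs_sub_comm p q]
  refine mul_le_mul ?_ (abs_max_sub_max_le_abs q p ε) (abs_nonneg _) (by positivity)
  refine one_div_le_one_div_of_le (by positivity) ?_
  rw [sq]
  exact mul_le_mul hp hq hε.le hp0.le

lemma sigmoid_logit {y : ℝ} (hy : y ∈ Ioo (0 : ℝ) 1) : Real.sigmoid (logit y) = y := by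
  have h1 := sub_pos.2 hy.2
  have h0 := hy.1
  rw [Real.sigmoid_def, logit, neg_sub, Real.exp_sub, Real.exp_log h1, Real.exp_log h0]
  field_simp
  ring

/-- The vector field of the first order system in the variables `φ = logit F` and
`u = w + ∫ m`, which make it continuous in time. The denominator `w` is cut off at `ε`. -/
noncomputable def cutoffField (m : ℝ → ℝ) (ε t : ℝ) (p : ℝ × ℝ) : ℝ × ℝ :=
  (1 / max (p.2 - ∫ y in (0 : ℝ)..t, m y) ε, 1 - Real.sigmoid p.1)

lemma continuousOn_primitive {m : ℝ → ℝ} (hm : m ∈ profiles) :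
    ContinuousOn (fun t => ∫ y in (0 : ℝ)..t, m y) (Icc 0 1) :=
  (HasACDeriv.of_primitive (intervalIntegrable_of_mem_profiles hm)
    (f := fun t => ∫ y in (0 : ℝ)..t, m y) fun x _ => by simp).continuousOn

lemma isPicardLindelof_cutoffField {m : ℝ → ℝ} (hm : m ∈ profiles) {ε : ℝ} (hε : 0 < ε)
    (p₀ : ℝ × ℝ) (r : ℝ≥0) :
    IsPicardLindelof (cutoffField m ε) (tmin := 0) (tmax := 1) ⟨0, by simp⟩ p₀
      (r + Real.toNNReal (1 / ε + 1)) r (Real.toNNReal (1 / ε + 1))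
      (Real.toNNReal (1 / ε ^ 2 + 1)) := by
  have hL : 0 ≤ 1 / ε + 1 := by positivity
  have hK : 0 ≤ 1 / ε ^ 2 + 1 := by positivity
  refine ⟨fun t _ => LipschitzWith.lipschitzOnWith (LipschitzWith.of_dist_le_mul fun p q => ?_),
    fun p _ => ?_, fun t _ p _ => ?_, ?_⟩
  · rw [Real.coe_toNNReal _ hK, Prod.dist_eq, Prod.dist_eq]
    simp only [cutoffField, Real.dist_eq]
    have h0 : 0 ≤ 1 / ε ^ 2 := by positivity
    refine max_le ?_ ?_
    · refine (abs_one_div_max_sub_le hε _ _).trans ?_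
      rw [sub_sub_sub_cancel_right]
      have := le_max_right |p.1 - q.1| |p.2 - q.2|
      have := abs_nonneg (p.2 - q.2)
      nlinarith
    · rw [sub_sub_sub_cancel_left, abs_sub_comm]
      refine (abs_sigmoid_sub_le _ _).trans ?_
      have := le_max_left |p.1 - q.1| |p.2 - q.2|
      have := abs_nonneg (p.1 - q.1)
      nlinarith
  · refine ContinuousOn.prodMk ?_ continuousOn_const
    refine continuousOn_const.div
      ((continuousOn_const.sub (continuousOn_primitive hm)).sup continuousOn_const)
      fun t _ => (lt_max_of_lt_right hε).ne'
  · rw [Real.coe_toNNReal _ hL, Prod.norm_def]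
    simp only [cutoffField, Real.norm_eq_abs]
    refine max_le ?_ ?_
    · rw [abs_of_nonneg (one_div_nonneg.2 (hε.le.trans (le_max_right _ _)))]
      have := one_div_le_one_div_of_le hε
        (le_max_right (p.2 - ∫ y in (0 : ℝ)..t, m y) ε)
      linarith
    · have h0 := Real.sigmoid_pos p.1
      have h1 := Real.sigmoid_lt_one p.1
      have : 0 < 1 / ε := by positivity
      rw [abs_le]
      constructor <;> linarith
  · simp

/-- If `w` moves with speed at most one and reaches `ε`, then `∫ 1 / max w ε` is large. -/
lemma log_le_integral_of_le {w : ℝ → ℝ} {ε x₀ : ℝ} (hε : 0 < ε) (hx₀ : x₀ ∈ Icc (0 : ℝ) 1)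
    (hwc : ContinuousOn w (Icc 0 1)) (hw : ∀ x ∈ Icc (0 : ℝ) 1, w x ≤ w x₀ + |x - x₀|)
    (hw₀ : w x₀ ≤ ε) : Real.log (1 + 1 / ε) ≤ ∫ x in (0 : ℝ)..1, 1 / max (w x) ε := by
  have hgc : Continuous fun x => (ε + |x - x₀|)⁻¹ :=
    Continuous.inv₀ (by fun_prop) fun x => by positivity
  have hmono : ∫ x in (0 : ℝ)..1, (ε + |x - x₀|)⁻¹ ≤ ∫ x in (0 : ℝ)..1, 1 / max (w x) ε := by
    refine intervalIntegral.integral_mono_on zero_le_one (hgc.intervalIntegrable _ _)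
      (intervalIntegrable_of_continuousOn ?_) fun x hx => ?_
    · exact continuousOn_const.div (hwc.sup continuousOn_const)
        fun x _ => (lt_max_of_lt_right hε).ne'
    · rw [← one_div]
      refine one_div_le_one_div_of_le (lt_max_of_lt_right hε) (max_le ?_ ?_)
      · linarith [hw x hx]
      · linarith [abs_nonneg (x - x₀)]
  have hsplit := intervalIntegral.integral_add_adjacent_intervals
    (hgc.intervalIntegrable (μ := volume) 0 x₀) (hgc.intervalIntegrable x₀ 1)
  have h1 : ∫ x in (0 : ℝ)..x₀, (ε + |x - x₀|)⁻¹ = Real.log ((ε + x₀) / ε) := by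
    have : ∫ x in (0 : ℝ)..x₀, (ε + |x - x₀|)⁻¹ = ∫ x in (0 : ℝ)..x₀, ((ε + x₀) - x)⁻¹ := by
      refine intervalIntegral.integral_congr fun x hx => ?_
      rw [uIcc_of_le hx₀.1] at hx
      simp only [abs_of_nonpos (sub_nonpos.2 hx.2)]
      ring_nf
    rw [this, intervalIntegral.integral_comp_sub_left (fun x => x⁻¹), add_sub_cancel_right,
      sub_zero, integral_inv_of_pos hε (by linarith [hx₀.1])]
  have h2 : ∫ x in x₀..1, (ε + |x - x₀|)⁻¹ = Real.log ((1 + (ε - x₀)) / ε) := by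
    have : ∫ x in x₀..1, (ε + |x - x₀|)⁻¹ = ∫ x in x₀..1, (x + (ε - x₀))⁻¹ := by
      refine intervalIntegral.integral_congr fun x hx => ?_
      rw [uIcc_of_le hx₀.2] at hx
      simp only [abs_of_nonneg (sub_nonneg.2 hx.1)]
      ring_nf
    rw [this, intervalIntegral.integral_comp_add_right (fun x => x⁻¹), add_sub_cancel,
      integral_inv_of_pos hε (by linarith [hx₀.2])]
  refine le_trans ?_ hmono
  have h3 : 0 < ε + x₀ := by linarith [hx₀.1]
  have h4 : 0 < 1 + (ε - x₀) := by linarith [hx₀.2]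
  rw [← hsplit, h1, h2, ← Real.log_mul (by positivity) (by positivity)]
  refine Real.log_le_log (by positivity) ?_
  rw [div_mul_div_comm, le_div_iff₀ (by positivity)]
  have h5 : (1 + 1 / ε) * (ε * ε) = ε * ε + ε := by field_simp
  nlinarith [mul_nonneg hx₀.1 (sub_nonneg.2 hx₀.2)]

/-- Shooting: the initial value of `w` is adjusted so that `φ` gains `logit β - logit α`. If `w`
ever reached the cutoff, the gain would be too large. -/
theorem exists_isFirstOrderSolution {α β : ℝ} (hα : 0 < α) (hαβ : α < β) (hβ : β < 1)
    {m : ℝ → ℝ} (hm : m ∈ profiles) :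
    ∃ F w, IsFirstOrderSolution m F w ∧ F 0 = α ∧ F 1 = β := by
  have hαm : α ∈ Ioo (0 : ℝ) 1 := ⟨hα, hαβ.trans hβ⟩
  have hβm : β ∈ Ioo (0 : ℝ) 1 := ⟨hα.trans hαβ, hβ⟩
  set a := logit α with ha
  set B := logit β - logit α with hB
  have hB0 : 0 < B := sub_pos.2 (strictMonoOn_logit hαm hβm hαβ)
  set ε := Real.exp (-B) with hεdef
  have hε : 0 < ε := Real.exp_pos _
  have hεB : B < Real.log (1 + 1 / ε) := by
    rw [hεdef, Real.exp_neg, one_div, inv_inv, Real.lt_log_iff_exp_lt (by positivity)]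
    linarith
  set R : ℝ := 1 + 1 / B with hR
  have hR0 : 0 < R := by positivity
  obtain ⟨Φ, hΦ, hΦc⟩ := (isPicardLindelof_cutoffField hm hε (a, ε)
    (Real.toNNReal R)).exists_forall_mem_closedBall_eq_hasDerivWithinAt_continuousOn
  rw [Real.coe_toNNReal _ hR0.le] at hΦ hΦc
  have hball : ∀ c ∈ Icc ε (ε + R), (a, c) ∈ Metric.closedBall (a, ε) R := fun c hc => by
    rw [Metric.mem_closedBall, Prod.dist_eq, dist_self, Real.dist_eq, abs_of_nonneg (by
      linarith [hc.1])]
    exact max_le hR0.le (by linarith [hc.2])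
  set φ : ℝ → ℝ → ℝ := fun c x => (Φ ((a, c), x)).1 with hφ
  set w : ℝ → ℝ → ℝ := fun c x => (Φ ((a, c), x)).2 - ∫ y in (0 : ℝ)..x, m y with hw
  have hφ0 : ∀ c ∈ Icc ε (ε + R), φ c 0 = a := fun c hc => by
    have := (hΦ _ (hball c hc)).1
    simp only [hφ]
    rw [this]
  have hw0 : ∀ c ∈ Icc ε (ε + R), w c 0 = c := fun c hc => by
    have := (hΦ _ (hball c hc)).1
    simp only [hw]
    rw [this]
    simp
  have hφd : ∀ c ∈ Icc ε (ε + R), ∀ x ∈ Icc (0 : ℝ) 1,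
      HasDerivWithinAt (φ c) (1 / max (w c x) ε) (Icc 0 1) x :=
    fun c hc x hx => ((hΦ _ (hball c hc)).2 x hx).fst
  have hφc : ∀ c ∈ Icc ε (ε + R), ContinuousOn (φ c) (Icc 0 1) :=
    fun c hc x hx => (hφd c hc x hx).continuousWithinAt
  have hmAC : HasACDeriv (fun t => ∫ y in (0 : ℝ)..t, m y) m :=
    .of_primitive (intervalIntegrable_of_mem_profiles hm) fun x _ => by simp
  have hwAC : ∀ c ∈ Icc ε (ε + R),
      HasACDeriv (w c) (fun x => 1 - Real.sigmoid (φ c x) - m x) := fun c hc =>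
    (HasACDeriv.of_hasDerivWithinAt (fun x hx => ((hΦ _ (hball c hc)).2 x hx).snd)
      (continuousOn_const.sub (continuous_sigmoid.comp_continuousOn (hφc c hc)))).sub hmAC
  have hwlip : ∀ c ∈ Icc ε (ε + R), ∀ x ∈ Icc (0 : ℝ) 1, ∀ y ∈ Icc (0 : ℝ) 1,
      |w c y - w c x| ≤ |y - x| := by
    intro c hc x hx y hy
    rw [← (hwAC c hc).integral_eq_sub hx hy, ← Real.norm_eq_abs, ← one_mul |y - x|]
    refine intervalIntegral.norm_integral_le_of_norm_le_const fun z hz => ?_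
    have hz' := hm.2 z (ordConnected_Icc.uIcc_subset hx hy (uIoc_subset_uIcc hz))
    have h0 := Real.sigmoid_pos (φ c z)
    have h1 := Real.sigmoid_lt_one (φ c z)
    rw [Real.norm_eq_abs, abs_le]
    constructor <;> linarith [hz'.1, hz'.2]
  have hcut : ∀ c ∈ Icc ε (ε + R), ContinuousOn (fun x => 1 / max (w c x) ε) (Icc 0 1) :=
    fun c hc => continuousOn_const.div ((hwAC c hc).continuousOn.sup continuousOn_const)
      fun x _ => (lt_max_of_lt_right hε).ne'
  have hgain : ∀ c ∈ Icc ε (ε + R), φ c 1 = a + ∫ x in (0 : ℝ)..1, 1 / max (w c x) ε :=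
    fun c hc => by
      rw [(HasACDeriv.of_hasDerivWithinAt (hφd c hc) (hcut c hc)).integral_eq_sub
        (by simp) (by simp), hφ0 c hc, add_sub_cancel]
  have hlarge : ∀ c ∈ Icc ε (ε + R), ∀ x₀ ∈ Icc (0 : ℝ) 1, w c x₀ ≤ ε → logit β < φ c 1 := by
    intro c hc x₀ hx₀ hle
    have := log_le_integral_of_le hε hx₀ (hwAC c hc).continuousOn
      (fun x hx => by linarith [(abs_le.1 (hwlip c hc x₀ hx₀ x hx)).2]) hle
    rw [hgain c hc]
    linarith
  have hεm : ε ∈ Icc ε (ε + R) := ⟨le_rfl, by linarith⟩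
  have hRm : ε + R ∈ Icc ε (ε + R) := ⟨by linarith, le_rfl⟩
  have hsmall : φ (ε + R) 1 ≤ logit β := by
    have : ∫ x in (0 : ℝ)..1, 1 / max (w (ε + R) x) ε ≤ ∫ x in (0 : ℝ)..1, B := by
      refine intervalIntegral.integral_mono_on zero_le_one
        (intervalIntegrable_of_continuousOn (hcut _ hRm)) (by simp) fun x hx => ?_
      have h1 := (abs_le.1 (hwlip _ hRm 0 (by simp) x hx)).1
      rw [hw0 _ hRm, sub_zero, abs_of_nonneg hx.1] at h1
      have h2 : 1 / B ≤ max (w (ε + R) x) ε := le_max_of_le_left (by linarith [hx.2])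
      simpa using one_div_le_one_div_of_le (by positivity) h2
    rw [hgain _ hRm]
    simp only [intervalIntegral.integral_const, sub_zero, one_smul] at this
    linarith
  have hcont : ContinuousOn (fun c => φ c 1) (Icc ε (ε + R)) := by
    refine continuous_fst.comp_continuousOn (hΦc.comp (by fun_prop) fun c hc => ?_)
    exact ⟨hball c hc, by simp⟩
  obtain ⟨c, hc, hcβ⟩ := intermediate_value_Icc' (show ε ≤ ε + R by linarith) hcont
    ⟨hsmall, (hlarge ε hεm 0 (by simp) (hw0 ε hεm).le).le⟩
  have hwε : ∀ x ∈ Icc (0 : ℝ) 1, ε < w c x := fun x hx => by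
    by_contra h
    exact (hlarge c hc x hx (not_lt.1 h)).ne' hcβ
  refine ⟨fun x => Real.sigmoid (φ c x), w c, ⟨fun x _ => ⟨Real.sigmoid_pos _,
    Real.sigmoid_lt_one _⟩, fun x hx => hε.trans (hwε x hx), fun x hx => ?_, fun x hx => ?_⟩,
    ?_, ?_⟩
  · have h := (Real.hasDerivAt_sigmoid (φ c x)).comp_hasDerivWithinAt x (hφd c hc x hx)
    rw [max_eq_left (hwε x hx).le] at h
    exact h.congr_deriv (by ring)
  · rw [(hwAC c hc).integral_eq_sub (by simp) hx]
    ring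
  · simp only [hφ0 c hc, ha, sigmoid_logit hαm]
  · simp only at hcβ
    simp only [hcβ, sigmoid_logit hβm]

theorem exists_isBVPSolution {α β : ℝ} (hα : 0 < α) (hαβ : α ≤ β) (hβ : β < 1)
    {m : ℝ → ℝ} (hm : m ∈ profiles) : ∃ F, IsBVPSolution α β m F := by
  rcases hαβ.eq_or_lt with rfl | hlt
  · exact ⟨_, isBVPSolution_const α m⟩
  · obtain ⟨F, w, h, h0, h1⟩ := exists_isFirstOrderSolution hα hlt hβ hm
    exact ⟨F, h.isBVPSolution hm h0 h1⟩

/-! ### The location of the jump -/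

lemma optTime_of_le {y : ℝ} (hy : y ≤ 1 / 2) : optTime y = -Real.log (2 * (1 - y)) := if_pos hy

/-- The jump sits where `optTime α + (optTime β - optTime α) x`, hence `F - 1/2`, changes sign. -/
lemma isSaddlePoint_mixed {α β : ℝ} (hα : 0 < α) (hαβ : α < β) (hβ : β < 1) (h1 : α ≤ 1 / 2)
    (h2 : 1 / 2 ≤ β) : ∃ F, IsSaddlePoint α β
      (Real.log (2 * (1 - α)) / Real.log (4 * (1 - α) * β)) F := by
  have hp : 0 ≤ Real.log (2 * (1 - α)) := Real.log_nonneg (by linarith)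
  have hq : 0 ≤ Real.log (2 * β) := Real.log_nonneg (by linarith)
  have hlog : Real.log (4 * (1 - α) * β) = Real.log (2 * (1 - α)) + Real.log (2 * β) := by
    rw [← Real.log_mul (by linarith) (by linarith)]
    ring_nf
  have hpos : 0 < Real.log (2 * (1 - α)) + Real.log (2 * β) := by
    rw [← hlog]
    refine Real.log_pos ?_
    nlinarith [mul_nonneg (sub_nonneg.2 h1) (sub_nonneg.2 h2)]
  rw [hlog]
  refine ⟨_, isSaddlePoint_optCurve hα hαβ hβ
    ⟨div_nonneg hp hpos.le, (div_le_one hpos).2 (by linarith)⟩ (fun x _ h => ?_)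
    fun x _ h => ?_⟩
  · rw [lt_div_iff₀ hpos] at h
    rw [optTime_of_le h1, optTime_of_ge h2]
    linarith
  · rw [div_le_iff₀ hpos] at h
    rw [optTime_of_le h1, optTime_of_ge h2]
    linarith

lemma isSaddlePoint_zero {α β : ℝ} (hα : 0 < α) (hαβ : α ≤ β) (hβ : β < 1) (h : 1 / 2 ≤ α) :
    ∃ F, IsSaddlePoint α β 0 F := by
  rcases hαβ.eq_or_lt with rfl | hlt
  · exact ⟨_, isSaddlePoint_const hα hβ (by simp) (fun x hx h' => absurd hx.1 h'.not_gt)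
      fun _ _ _ => h⟩
  · refine ⟨_, isSaddlePoint_optCurve hα hlt hβ (by simp)
      (fun x hx h' => absurd hx.1 h'.not_gt) fun x hx _ => ?_⟩
    rw [optTime_of_ge h, optTime_of_ge (h.trans hαβ)]
    have h1 : 0 ≤ Real.log (2 * α) := Real.log_nonneg (by linarith)
    have h2 : Real.log (2 * α) ≤ Real.log (2 * β) := Real.log_le_log (by linarith) (by linarith)
    nlinarith [mul_nonneg (sub_nonneg.2 h2) hx.1.le]

lemma isSaddlePoint_one {α β : ℝ} (hα : 0 < α) (hαβ : α ≤ β) (hβ : β < 1) (h : β ≤ 1 / 2) :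
    ∃ F, IsSaddlePoint α β 1 F := by
  rcases hαβ.eq_or_lt with rfl | hlt
  · exact ⟨_, isSaddlePoint_const hα hβ (by simp) (fun _ _ _ => h)
      fun x hx h' => absurd hx.2 h'.not_gt⟩
  · refine ⟨_, isSaddlePoint_optCurve hα hlt hβ (by simp) (fun x hx _ => ?_)
      fun x hx h' => absurd hx.2 h'.not_gt⟩
    rw [optTime_of_le h, optTime_of_le (hαβ.trans h)]
    have h1 : 0 ≤ Real.log (2 * (1 - β)) := Real.log_nonneg (by linarith)
    have h2 : Real.log (2 * (1 - β)) ≤ Real.log (2 * (1 - α)) :=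
      Real.log_le_log (by linarith) (by linarith)
    nlinarith [mul_nonneg (sub_nonneg.2 h2) (sub_nonneg.2 hx.2.le)]

lemma exists_isSaddlePoint {α β : ℝ} (hα : 0 < α) (hαβ : α ≤ β) (hβ : β < 1) :
    ∃ x₀ F, IsSaddlePoint α β x₀ F := by
  rcases le_total (1 / 2) α with h | h
  · exact ⟨_, isSaddlePoint_zero hα hαβ hβ h⟩
  rcases le_total β (1 / 2) with h' | h'
  · exact ⟨_, isSaddlePoint_one hα hαβ hβ h'⟩
  rcases hαβ.eq_or_lt with rfl | hlt
  · exact ⟨_, isSaddlePoint_zero hα hαβ hβ h'⟩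
  · exact ⟨_, isSaddlePoint_mixed hα hlt hβ h h'⟩

end SSEP

theorem lemmas04 (α β : ℝ) (hα : 0 < α) (hαβ : α ≤ β) (hβ : β < 1) :
    -- the boundary value problem defining `V` is well posed for every profile
    (∀ m ∈ SSEP.profiles,
      (∃ F, SSEP.IsBVPSolution α β m F) ∧
      ∀ F₁ F₂, SSEP.IsBVPSolution α β m F₁ → SSEP.IsBVPSolution α β m F₂ →
        Set.EqOn F₁ F₂ (Set.Icc (0 : ℝ) 1)) ∧
    -- both infima are equal to `E₋`
    IsGLB ((fun m => SSEP.V α β m + SSEP.S m) '' SSEP.profiles) (SSEP.Eminus α β) ∧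
    IsGLB ((fun m => SSEP.V α β m + SSEP.S m) '' SSEP.stepProfiles) (SSEP.Eminus α β) ∧
    -- a minimizing profile
    (α ≤ 1 / 2 → 1 / 2 ≤ β → α < β →
      SSEP.step (Real.log (2 * (1 - α)) / Real.log (4 * (1 - α) * β)) ∈ SSEP.stepProfiles ∧
      SSEP.V α β (SSEP.step (Real.log (2 * (1 - α)) / Real.log (4 * (1 - α) * β)))
        + SSEP.S (SSEP.step (Real.log (2 * (1 - α)) / Real.log (4 * (1 - α) * β)))
        = SSEP.Eminus α β) ∧
    (1 / 2 ≤ α → SSEP.V α β (SSEP.step 0) + SSEP.S (SSEP.step 0) = SSEP.Eminus α β) ∧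
    (β ≤ 1 / 2 → SSEP.V α β (SSEP.step 1) + SSEP.S (SSEP.step 1) = SSEP.Eminus α β) ∧
    -- the min-max identity
    (⨅ m ∈ SSEP.profiles, ⨆ F ∈ SSEP.increasingC1 α β, SSEP.G α β m F)
      = (⨆ F ∈ SSEP.increasingC1 α β, ⨅ m ∈ SSEP.profiles, SSEP.G α β m F) ∧
    (⨅ m ∈ SSEP.profiles, ⨆ F ∈ SSEP.increasingC1 α β, SSEP.G α β m F)
      = ((SSEP.Eminus α β : ℝ) : EReal) := by
  
  obtain ⟨x₀, F, hs⟩ := SSEP.exists_isSaddlePoint hα hαβ hβ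
  have hlow : ∀ m ∈ SSEP.profiles, SSEP.Eminus α β ≤ SSEP.V α β m + SSEP.S m := fun m hm => by
    obtain ⟨H, hH⟩ := SSEP.exists_isBVPSolution hα hαβ hβ hm
    exact hs.le_V_add_S hα hαβ hβ hm hH
  have hval := hs.V_add_S_step hα hαβ hβ
  refine ⟨fun m hm => ⟨SSEP.exists_isBVPSolution hα hαβ hβ hm,
    fun F₁ F₂ h₁ h₂ => h₁.eqOn hα hαβ hβ hm h₂⟩, ⟨?_, fun b hb => ?_⟩, ⟨?_, fun b hb => ?_⟩,
    fun h₁ h₂ hlt => ?_, fun h => ?_, fun h => ?_, ?_, hs.iInf_iSup_G hα hαβ hβ⟩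
  · rintro _ ⟨m, hm, rfl⟩
    exact hlow m hm
  · rw [← hval]
    exact hb ⟨_, SSEP.step_mem_profiles x₀, rfl⟩
  · rintro _ ⟨_, ⟨x, -, rfl⟩, rfl⟩
    exact hlow _ (SSEP.step_mem_profiles x)
  · rw [← hval]
    exact hb ⟨_, ⟨x₀, hs.mem, rfl⟩, rfl⟩
  · obtain ⟨H, hH⟩ := SSEP.isSaddlePoint_mixed hα hlt hβ h₁ h₂
    exact ⟨⟨_, hH.mem, rfl⟩, hH.V_add_S_step hα hαβ hβ⟩
  · obtain ⟨H, hH⟩ := SSEP.isSaddlePoint_zero hα hαβ hβ h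
    exact hH.V_add_S_step hα hαβ hβ
  · obtain ⟨H, hH⟩ := SSEP.isSaddlePoint_one hα hαβ hβ h
    exact hH.V_add_S_step hα hαβ hβ
  · rw [hs.iInf_iSup_G hα hαβ hβ, hs.iSup_iInf_G hα hαβ hβ]
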